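/- Let $k>l\ge 2$ be coprime integers, let $m\ge 2$, $p\ge 0$ and $m_1,\dots,m_p\ge 0$ be integers, and let $c_1,\dots,c_p\in\mathbb C\setminus\{0\}$ be distinct. Let $X'$ be the set of common zeros, in the complex affine space with coordinates $x,y,z,v_i$ $(1\le i\le m)$ and $u_{s,i}$ $(1\le s\le p,\ 1\le i\le m_s)$, of the polynomials $$xv_1-(y^k-z^l),\qquad xv_{i+1}-v_i^{n_i}+q_i(y,z,v_1,\dots,v_i)\quad(1\le i<m),$$ $$(x-c_s)u_{s,1}-r_{s,0}(y,z),\qquad (x-c_s)u_{s,i+1}-u_{s,i}^{n_{s,i}}+r_{s,i}(y,z,u_{s,1},\dots,u_{s,i})\quad(1\le i<m_s),$$ where $n_i,n_{s,i}\geq 1$ are integers, the $q_i$ and $r_{s,i}$ are polynomials over $\mathbb C$, for $j\le i$ the degree of $q_i$ in $v_j$ is less than $n_j$, and for $1\le j\le i$ the degree of $r_{s,i}$ in $u_{s,j}$ is less than $n_{s,j}$. Let $A'=\mathbb C[X']$ be the quotient of the polynomial ring by the ideal of all polynomials vanishing on $X'$. Give the variables real weights $d_x,d_y,d_z,d_i=d(v_i),d_{s,i}=d(u_{s,i})$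 such that $kd_y=ld_z$; $d_1+d_x=kd_y$; $d_1$ and $d_x$ are linearly independent over $\mathbb Q$; $d_x<0<d_y$; $d_x+d_{i+1}=n_id_i$ for $1\le i<m$; $d_x+d_{s,i+1}=n_{s,i}d_{s,i}$ for $1\le i<m_s$; and $d_1\ge C d_y$, $d_{s,1}\ge C d_y$ for all $s$ with $m_s\ge1$. Here $C$ is a sufficiently large real constant that depends only on the polynomial system. For a polynomial, $d$ denotes the maximum of the weights of its monomials. Let $F^t\subset A'$ be the space of all elements represented by a polynomial of $d$-degree at most $t$ $(t\in\mathbb R)$, let $\widehat A'=\bigoplus_{t\in\mathbb R}F^t/\bigcup_{s<t}F^s$ be the associated graded algebra, call the elements of its summands $d$-homogeneous, and let $\tilde x,\tilde y,\tilde z,\tilde v_i\in\widehat A'$ be the classes of $x,y,z,v_i$ in degrees $d_x,d_y,d_z,d_i$. For $a_1,a_2,a\in\widehat A'$ let $J_0(a_1,a_2,a)$ be the Jacobian of $a_1,a_2,a$ with respect to $\tilde x,\tilde y,\tilde z$, i.e. the determinant of their partial derivatives, computed in the fraction field of $\widehat A'$. Suppose that $a_1,a_2\in\widehat A'$ are irreducible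 and $d$-homogeneous and that $\partial(a)=\tilde x^mJ_0(a_1,a_2,a)$ is a nonzero locally nilpotent derivation of $\widehat A'$. Then (1) up to order and up to nonzero constant factors, $(a_1,a_2)$ is one of the pairs $(\tilde x,\tilde y)$, $(\tilde x,\tilde z)$; (2) $\tilde x\in\operatorname{Ker}\partial$, and $\deg_\partial(\tilde v_i)\ge2$ for every $i=1,\dots,m$, where $\deg_\partial(a)=\max\{k\ge 0: \partial^k(a)\ne0\}$ for $a\neq 0$. -/

import Mathlib

noncomputable section

/-! ### Filtrations indexed by `ℝ` and the associated graded algebra -/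

/-- An ascending filtration of a commutative `ℂ`-algebra, indexed by the real numbers and
compatible with the multiplication. -/
structure RealFiltration (A : Type*) [CommRing A] [Algebra ℂ A] where
  F : ℝ → Submodule ℂ A
  mono : ∀ {s t : ℝ}, s ≤ t → F s ≤ F t
  one_mem : (1 : A) ∈ F 0
  mul_mem : ∀ {s t : ℝ} {a b : A}, a ∈ F s → b ∈ F t → a * b ∈ F (s + t)

namespace RealFiltration

variable {A : Type*} [CommRing A] [Algebra ℂ A] (𝓕 : RealFiltration A)

/-- The subspace `⋃_{s < t} F s`. -/
def lt (t : ℝ) : Submodule ℂ A where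
  carrier := {a | ∃ s < t, a ∈ 𝓕.F s}
  zero_mem' := ⟨t - 1, by linarith, Submodule.zero_mem _⟩
  add_mem' := by
    rintro a b ⟨s, hs, ha⟩ ⟨s', hs', hb⟩
    exact ⟨max s s', max_lt hs hs',
      Submodule.add_mem _ (𝓕.mono (le_max_left _ _) ha) (𝓕.mono (le_max_right _ _) hb)⟩
  smul_mem' := by
    rintro c a ⟨s, hs, ha⟩
    exact ⟨s, hs, Submodule.smul_mem _ c ha⟩

theorem lt_mul_mem {s t : ℝ} {a b : A} (ha : a ∈ 𝓕.F s) (hb : b ∈ 𝓕.lt t) :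
    a * b ∈ 𝓕.lt (s + t) := by
  obtain ⟨r, hr, hb⟩ := hb
  exact ⟨s + r, by linarith, 𝓕.mul_mem ha hb⟩

/-- The algebra `⊕_t F t` (inside the algebra of all finite sums `∑ a_t T^t`, `a_t ∈ A`). -/
def rees : Subalgebra ℂ (AddMonoidAlgebra A ℝ) where
  carrier := {f | ∀ t, f.coeff t ∈ 𝓕.F t}
  add_mem' := by
    intro f g hf hg t
    simpa using Submodule.add_mem _ (hf t) (hg t)
  mul_mem' := by
    classical
    intro f g hf hg t
    rw [AddMonoidAlgebra.coeff_mul]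
    refine Submodule.sum_mem _ fun s _ => Submodule.sum_mem _ fun s' _ => ?_
    dsimp only
    split_ifs with h
    · rw [← h]; exact 𝓕.mul_mem (hf s) (hg s')
    · exact Submodule.zero_mem _
  algebraMap_mem' := by
    classical
    intro c t
    have h : (algebraMap ℂ (AddMonoidAlgebra A ℝ) c).coeff t
        = if (0 : ℝ) = t then c • (1 : A) else 0 := by
      rw [Algebra.algebraMap_eq_smul_one, AddMonoidAlgebra.one_def, AddMonoidAlgebra.coeff_smul,
        Finsupp.smul_apply, AddMonoidAlgebra.coeff_single, Finsupp.single_apply]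
      split_ifs <;> simp
    rw [h]
    split_ifs with h0
    · rw [← h0]; exact Submodule.smul_mem _ c 𝓕.one_mem
    · exact Submodule.zero_mem _

/-- The ideal `⊕_t ⋃_{s < t} F s` of `⊕_t F t`. -/
def reesLt : Ideal 𝓕.rees where
  carrier := {f | ∀ t, f.1.coeff t ∈ 𝓕.lt t}
  zero_mem' := fun t => by simp
  add_mem' := by
    intro f g hf hg t
    simpa using Submodule.add_mem _ (hf t) (hg t)
  smul_mem' := by
    classical
    intro f g hg t
    change (f.1 * g.1).coeff t ∈ _
    rw [AddMonoidAlgebra.coeff_mul]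
    refine Submodule.sum_mem _ fun s _ => Submodule.sum_mem _ fun s' _ => ?_
    dsimp only
    split_ifs with h
    · rw [← h]; exact 𝓕.lt_mul_mem (f.2 s) (hg s')
    · exact Submodule.zero_mem _

/-- The associated graded algebra `Gr A = ⊕_t F t / ⋃_{s < t} F s`. The product of the classes of
`a ∈ F s` and `b ∈ F t` is the class of `a * b` in degree `s + t`. -/
def Gr : Type _ := 𝓕.rees ⧸ 𝓕.reesLt

instance : CommRing 𝓕.Gr := inferInstanceAs (CommRing (𝓕.rees ⧸ 𝓕.reesLt))

instance : Algebra ℂ 𝓕.Gr := inferInstanceAs (Algebra ℂ (𝓕.rees ⧸ 𝓕.reesLt))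

/-- The class in `F t / ⋃_{s < t} F s ⊆ Gr A` of an element of `F t`. -/
def symbol (t : ℝ) (a : 𝓕.F t) : 𝓕.Gr :=
  Ideal.Quotient.mk 𝓕.reesLt ⟨AddMonoidAlgebra.single t a.1, by
    classical
    intro s
    rw [AddMonoidAlgebra.coeff_single, Finsupp.single_apply]
    split_ifs with h
    · rw [← h]; exact a.2
    · exact Submodule.zero_mem _⟩

/-- An element of `Gr A` is homogeneous if it lies in one of the summands. -/
def IsHomogeneousElt (g : 𝓕.Gr) : Prop := ∃ (t : ℝ) (a : 𝓕.F t), g = 𝓕.symbol t a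

end RealFiltration

/-! ### Weight filtrations on algebras of regular functions -/

/-- The weight filtration of `ℂ[σ] / I` for the weights `d` : its `t`-th member consists of the
classes of all polynomials of weight degree at most `t`. -/
def weightFiltration {σ : Type*} (d : σ → ℝ) (I : Ideal (MvPolynomial σ ℂ)) :
    RealFiltration (MvPolynomial σ ℂ ⧸ I) where
  F t :=
    { carrier := {a | ∃ p : MvPolynomial σ ℂ,
        (∀ μ ∈ p.support, Finsupp.weight d μ ≤ t) ∧ Ideal.Quotient.mk I p = a}
      zero_mem' := ⟨0, by simp, by simp⟩
      add_mem' := by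
        classical
        rintro _ _ ⟨p, hp, rfl⟩ ⟨q, hq, rfl⟩
        refine ⟨p + q, fun μ hμ => ?_, map_add _ _ _⟩
        rcases Finset.mem_union.1 (MvPolynomial.support_add hμ) with h | h
        exacts [hp μ h, hq μ h]
      smul_mem' := by
        rintro c _ ⟨p, hp, rfl⟩
        exact ⟨c • p, fun μ hμ => hp μ (MvPolynomial.support_smul hμ), rfl⟩ }
  mono := by
    rintro s t hst _ ⟨p, hp, rfl⟩
    exact ⟨p, fun μ hμ => (hp μ hμ).trans hst, rfl⟩
  one_mem := by
    classical
    refine ⟨1, fun μ hμ => ?_, map_one _⟩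
    have h : μ = 0 := by
      by_contra h
      rw [MvPolynomial.mem_support_iff, MvPolynomial.coeff_one, if_neg (Ne.symm h)] at hμ
      exact hμ rfl
    simp [h]
  mul_mem := by
    classical
    rintro s t _ _ ⟨p, hp, rfl⟩ ⟨q, hq, rfl⟩
    refine ⟨p * q, fun μ hμ => ?_, map_mul _ _ _⟩
    obtain ⟨a, ha, b, hb, rfl⟩ := Finset.mem_add.1 (MvPolynomial.support_mul p q hμ)
    rw [map_add]
    exact add_le_add (hp a ha) (hq b hb)

theorem mk_X_mem_weightFiltration {σ : Type*} (d : σ → ℝ) (I : Ideal (MvPolynomial σ ℂ)) (j : σ) :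
    Ideal.Quotient.mk I (MvPolynomial.X j) ∈ (weightFiltration d I).F (d j) := by
  refine ⟨MvPolynomial.X j, fun μ hμ => ?_, rfl⟩
  rw [MvPolynomial.support_X, Finset.mem_singleton] at hμ
  simp [hμ, Finsupp.weight_single]

/-- The element of the associated graded algebra of `ℂ[σ] / I` given by the coordinate function
`j`, placed in degree `d j`. -/
def grCoord {σ : Type*} (d : σ → ℝ) (I : Ideal (MvPolynomial σ ℂ)) (j : σ) :
    (weightFiltration d I).Gr :=
  (weightFiltration d I).symbol (d j)
    ⟨Ideal.Quotient.mk I (MvPolynomial.X j), mk_X_mem_weightFiltration d I j⟩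

/-! ### The varieties `X'` -/

/-- The coordinates `x, y, z, v_1, …, v_m` and `u_{s,1}, …, u_{s,M s}` (`s = 1, …, p`). In the code
the indices of `v`, of `u_s` and of the roots `c_s` start from `0`. -/
inductive Coord (m p : ℕ) (M : Fin p → ℕ) : Type
  | x : Coord m p M
  | y : Coord m p M
  | z : Coord m p M
  | v : Fin m → Coord m p M
  | u : (s : Fin p) → Fin (M s) → Coord m p M

/-- The exponents, polynomials and roots that enter the system of equations of `X'`.
The polynomial `q i` and the exponent `n i` belong to the equation that
contains `x * v_{i+1}`, and similarly for `r s i` and `N s i`; the values at the last index, for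
which there is no such equation, play no role. -/
structure SystemData (m p : ℕ) (M : Fin p → ℕ) where
  k : ℕ
  l : ℕ
  coprime : Nat.Coprime k l
  two_le_l : 2 ≤ l
  l_lt_k : l < k
  n : Fin m → ℕ
  q : Fin m → MvPolynomial (Coord m p M) ℂ
  q_supported : ∀ i : Fin m, (i : ℕ) + 1 < m →
    q i ∈ MvPolynomial.supported ℂ ({Coord.y, Coord.z} ∪ {w | ∃ j ≤ i, w = Coord.v j})
  q_degree : ∀ i j : Fin m, (i : ℕ) + 1 < m → j ≤ i → (q i).degreeOf (Coord.v j) < n j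
  c : Fin p → ℂ
  c_ne_zero : ∀ s, c s ≠ 0
  c_injective : Function.Injective c
  N : (s : Fin p) → Fin (M s) → ℕ
  r₀ : Fin p → MvPolynomial (Coord m p M) ℂ
  r₀_supported : ∀ s, r₀ s ∈ MvPolynomial.supported ℂ {Coord.y, Coord.z}
  r : (s : Fin p) → Fin (M s) → MvPolynomial (Coord m p M) ℂ
  r_supported : ∀ (s : Fin p) (i : Fin (M s)), (i : ℕ) + 1 < M s →
    r s i ∈ MvPolynomial.supported ℂ ({Coord.y, Coord.z} ∪ {w | ∃ j ≤ i, w = Coord.u s j})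
  r_degree : ∀ (s : Fin p) (i j : Fin (M s)), (i : ℕ) + 1 < M s → j ≤ i →
    (r s i).degreeOf (Coord.u s j) < N s j

namespace SystemData

open MvPolynomial

variable {m p : ℕ} {M : Fin p → ℕ} (S : SystemData m p M)

/-- The left-hand sides of the equations
`x v_1 - (y^k - z^l) = 0`, `x v_{i+1} - v_i^{n_i} + q_i = 0`,
`(x - c_s) u_{s,1} - r_{s,0} = 0`, `(x - c_s) u_{s,i+1} - u_{s,i}^{n_{s,i}} + r_{s,i} = 0`. -/
inductive IsEquation : MvPolynomial (Coord m p M) ℂ → Prop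
  | v_first (i : Fin m) (hi : (i : ℕ) = 0) :
      IsEquation (X .x * X (.v i) - (X .y ^ S.k - X .z ^ S.l))
  | v_next (i i' : Fin m) (hi : (i' : ℕ) = i + 1) :
      IsEquation (X .x * X (.v i') - X (.v i) ^ S.n i + S.q i)
  | u_first (s : Fin p) (i : Fin (M s)) (hi : (i : ℕ) = 0) :
      IsEquation ((X .x - C (S.c s)) * X (.u s i) - S.r₀ s)
  | u_next (s : Fin p) (i i' : Fin (M s)) (hi : (i' : ℕ) = i + 1) :
      IsEquation ((X .x - C (S.c s)) * X (.u s i') - X (.u s i) ^ S.N s i + S.r s i)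

/-- The variety `X'`. -/
def variety : Set (Coord m p M → ℂ) := {P | ∀ f, S.IsEquation f → eval P f = 0}

/-- The ideal `I'` of all polynomials vanishing on `X'`; thus `A' = ℂ[X']` is the quotient of the
polynomial ring by it. -/
def ideal : Ideal (MvPolynomial (Coord m p M) ℂ) := vanishingIdeal ℂ S.variety

/-- The conditions on the weights `d`; the real number `C` makes precise that the weights of `v_1`
and of the `u_{s,1}` are much bigger than the weight of `y`. -/
structure IsAdmissible (C : ℝ) (d : Coord m p M → ℝ) : Prop where
  y_z : S.k * d .y = S.l * d .z
  v_first : ∀ i : Fin m, (i : ℕ) = 0 → d (.v i) + d .x = S.k * d .y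
  indep : ∀ i : Fin m, (i : ℕ) = 0 → LinearIndependent ℚ ![d (.v i), d .x]
  x_neg : d .x < 0
  y_pos : 0 < d .y
  v_large : ∀ i : Fin m, (i : ℕ) = 0 → C * d .y ≤ d (.v i)
  v_next : ∀ i i' : Fin m, (i' : ℕ) = i + 1 → d .x + d (.v i') = S.n i * d (.v i)
  u_large : ∀ (s : Fin p) (i : Fin (M s)), (i : ℕ) = 0 → C * d .y ≤ d (.u s i)
  u_next : ∀ (s : Fin p) (i i' : Fin (M s)), (i' : ℕ) = i + 1 →
    d .x + d (.u s i') = S.N s i * d (.u s i)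

/-- The weight filtration of `A' = ℂ[X']`. -/
abbrev filtration (d : Coord m p M → ℝ) :
    RealFiltration (MvPolynomial (Coord m p M) ℂ ⧸ S.ideal) := weightFiltration d S.ideal

/-- The associated graded algebra `Â'` of `A' = ℂ[X']`. -/
abbrev GrA (d : Coord m p M → ℝ) : Type := (S.filtration d).Gr

/-- The coordinate functions (`x̃`, `ỹ`, `z̃`, `ṽ_i`, `ũ_{s,i}`) as elements of `Â'`. -/
abbrev coord (d : Coord m p M → ℝ) (j : Coord m p M) : S.GrA d := grCoord d S.ideal j

end SystemData

/-! ### Jacobians and locally nilpotent derivations -/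

/-- `D 0, D 1, D 2` are the partial derivatives `∂/∂ξ_0, ∂/∂ξ_1, ∂/∂ξ_2` with respect to the
coordinates `ξ` on the algebra `K`. -/
def IsPartialDerivatives {K : Type*} [CommRing K] [Algebra ℂ K] (ξ : Fin 3 → K)
    (D : Fin 3 → Derivation ℂ K K) : Prop :=
  ∀ i j, D i (ξ j) = if i = j then 1 else 0

/-- `∂(a) = x ^ e * J₀(a₁, a₂, a)` for all `a ∈ B`, where `J₀` is the Jacobian with respect to
`x, y, z`, computed in the ring of fractions of `B`. -/
def IsJacobianType {B : Type*} [CommRing B] [Algebra ℂ B] (x y z : B) (e : ℕ) (a₁ a₂ : B)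
    (δ : Derivation ℂ B B) : Prop :=
  ∃ D : Fin 3 → Derivation ℂ (FractionRing B) (FractionRing B),
    IsPartialDerivatives (fun j => algebraMap B (FractionRing B) (![x, y, z] j)) D ∧
    ∀ a : B, algebraMap B (FractionRing B) (δ a) =
      algebraMap B (FractionRing B) x ^ e *
        (Matrix.of fun i j => D j (algebraMap B (FractionRing B) (![a₁, a₂, a] i))).det

/-- Local nilpotency. -/
def IsLocallyNilpotent {B : Type*} [CommRing B] [Algebra ℂ B] (δ : Derivation ℂ B B) : Prop :=
  ∀ a : B, ∃ k : ℕ, δ^[k] a = 0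

/-- The degree function `deg_∂ a = max {k | ∂^k a ≠ 0}` of a locally nilpotent derivation
(for `a ≠ 0`). -/
def derivationDegree {B : Type*} [CommRing B] [Algebra ℂ B] (δ : Derivation ℂ B B) (a : B) : ℕ :=
  sSup {k : ℕ | δ^[k] a ≠ 0}

end

/-!
The associated graded algebra `Â'` is the subalgebra of `ℂ[x, x⁻¹, y, z]` generated by `x, y, z` and
`v_i = w ^ N_i / x ^ E_i`, where `w = y ^ k - z ^ l`: the symbols of the `u_{s,i}` vanish, as
`x - c_s` has the nonzero constant leading part `-c_s` (`SystemData.coord_u`), and only the leading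
parts of the equations for the `v_i` survive. Upper bounds for `Â'` come from these relations. Lower
bounds come from characters: `exp (-τ t) * a (P τ)` has a limit for `τ → ∞` when `a ∈ F t` and
`P τ` is the point of `X'` with coordinates `x, y, z` proportional to `exp (τ d_x)`, `exp (τ d_y)`,
`exp (τ d_z)`, and the limits separate the polynomials in `x, y, z` (`exists_character`,
`SystemData.exists_character_coord`). What is used of `Â'` afterwards is collected in the structure
`IsModification`.

In such an algebra the part of degree `g` in `x` is `x ^ g * w ^ β g * ℂ[y, z]`
(`IsModification.exists_leading_monomials`). Since the weights of `x` and `y` are linearly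
independent over `ℚ`, a homogeneous element is of the form `x ^ g * w ^ β g * h` with a weighted
homogeneous `h ∈ ℂ[y, z]`, which is a product of `y`, `z` and binomials `y ^ k - c * z ^ l`. Hence
the irreducible homogeneous elements are, up to constants, `x, y, z, v_i` and `y ^ k - c * z ^ l` with
`c ≠ 0, 1` (`IsModification.exists_eq_smul_primitive`).

For a locally nilpotent derivation `δ`, the degree function is additive on products, and it drops
by `1` under `δ`. This excludes all the pairs of irreducible elements except those of the
proposition (`IsModification.classification`):
* if `δ` annihilates `x` and a binomial in `y ^ k, z ^ l`, then, up to powers of `x`,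
  `z ^ (l - 1)` divides `δ y` and `y ^ (k - 1)` divides `δ z`, so each of `y, z` would have larger
  degree than the other (`IsModification.eq_zero_of_binomial`); a pair containing `x` and `v_i`, or
  two different `v_i`, reduces to this case, as `x` and `w` are then in the kernel;
* if `a₁, a₂` are polynomials in `y, z`, then `x` divides `δ x`, so `δ x = 0` and `δ = 0`
  (`IsJacobianType.eq_zero_of_evalYZ`);
* for one polynomial in `y, z` and one `v_i`, the explicit formula for `δ x` contradicts
  `E_i ≤ m * N_i` and `m ≥ 2` (`IsModification.not_isJacobianType_v`).
-/

/-! ### The degree function of a locally nilpotent derivation -/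

section LocallyNilpotent

variable {B : Type*} [CommRing B] [Algebra ℂ B] {δ : Derivation ℂ B B}

theorem iterate_derivation_zero (δ : Derivation ℂ B B) (n : ℕ) : δ^[n] 0 = 0 :=
  Function.iterate_fixed (map_zero δ) n

theorem iterate_derivation_add (δ : Derivation ℂ B B) (n : ℕ) (a b : B) :
    δ^[n] (a + b) = δ^[n] a + δ^[n] b := by
  induction n with
  | zero => rfl
  | succ n ih => simp only [Function.iterate_succ_apply', ih, map_add]

theorem iterate_derivation_eq_zero_of_le {a : B} {m n : ℕ} (h : m ≤ n) (ha : δ^[m] a = 0) :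
    δ^[n] a = 0 := by
  obtain ⟨j, rfl⟩ := Nat.exists_eq_add_of_le' h
  rw [Function.iterate_add_apply, ha, iterate_derivation_zero]

/-- The top term of the Leibniz rule for iterates of a derivation. -/
theorem iterate_derivation_mul (N : ℕ) : ∀ (p q : ℕ) (a b : B), p + q = N →
    δ^[p + 1] a = 0 → δ^[q + 1] b = 0 →
    δ^[N] (a * b) = (N.choose p : B) * (δ^[p] a * δ^[q] b) := by
  induction N with
  | zero =>
    intro p q a b h _ _
    obtain ⟨rfl, rfl⟩ : p = 0 ∧ q = 0 := by omega
    simp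
  | succ N ih =>
    intro p q a b h ha hb
    have h1 : δ^[N] (a * δ b) = (if q = 0 then 0 else (N.choose p : B)) * (δ^[p] a * δ^[q] b) := by
      rcases q with _ | q
      · have : δ b = 0 := hb
        simp [this]
      · rw [ih p q a (δ b) (by omega) ha hb]
        simp
    have h2 : δ^[N] (b * δ a) = (if p = 0 then 0 else (N.choose q : B)) * (δ^[p] a * δ^[q] b) := by
      rcases p with _ | p
      · have : δ a = 0 := ha
        simp [this]
      · rw [ih q p b (δ a) (by omega) hb ha]
        simp only [Nat.add_eq_zero_iff, one_ne_zero, and_false, if_false]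
        rw [Function.iterate_succ_apply]
        ring
    rw [Function.iterate_succ_apply, Derivation.leibniz, smul_eq_mul, smul_eq_mul,
      iterate_derivation_add, h1, h2, ← add_mul]
    congr 1
    rcases p with _ | p
    · have : q ≠ 0 := by omega
      simp [this]
    · rcases q with _ | q
      · obtain rfl : p = N := by omega
        simp
      · have : N.choose (q + 1) = N.choose p := Nat.choose_symm_of_eq_add (by omega)
        simp only [Nat.add_eq_zero_iff, one_ne_zero, and_false, if_false, this]
        rw [Nat.choose_succ_succ']
        push_cast
        ring

theorem derivationDegree_eq {a : B} {n : ℕ} (h0 : δ^[n] a ≠ 0) (h1 : δ^[n + 1] a = 0) :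
    derivationDegree δ a = n := by
  refine IsGreatest.csSup_eq ⟨h0, fun j hj => ?_⟩
  by_contra hlt
  exact hj (iterate_derivation_eq_zero_of_le (by omega) h1)

theorem IsLocallyNilpotent.degree_spec (hδ : IsLocallyNilpotent δ) {a : B} (ha : a ≠ 0) :
    δ^[derivationDegree δ a] a ≠ 0 ∧ δ^[derivationDegree δ a + 1] a = 0 := by
  classical
  have hex := hδ a
  have hpos : Nat.find hex ≠ 0 := fun h => ha (by simpa [h] using Nat.find_spec hex)
  obtain ⟨n, hn⟩ := Nat.exists_eq_succ_of_ne_zero hpos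
  have h1 : δ^[n + 1] a = 0 := by simpa [hn] using Nat.find_spec hex
  have h0 : δ^[n] a ≠ 0 := Nat.find_min hex (by omega)
  rw [derivationDegree_eq h0 h1]
  exact ⟨h0, h1⟩

theorem derivationDegree_eq_zero_of_ker {a : B} (h : δ a = 0) : derivationDegree δ a = 0 := by
  by_cases ha : a = 0
  · have : {k : ℕ | δ^[k] a ≠ 0} = ∅ := by
      ext k; simp [ha]
    simp [derivationDegree, this]
  · exact derivationDegree_eq (by simpa using ha) (by simpa using h)

theorem IsLocallyNilpotent.ker_of_degree_eq_zero (hδ : IsLocallyNilpotent δ) {a : B}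
    (h : derivationDegree δ a = 0) : δ a = 0 := by
  by_cases ha : a = 0
  · simp [ha]
  · simpa [h] using (hδ.degree_spec ha).2

theorem IsLocallyNilpotent.degree_map_add_one (hδ : IsLocallyNilpotent δ) {a : B} (h : δ a ≠ 0) :
    derivationDegree δ (δ a) + 1 = derivationDegree δ a := by
  have ha : a ≠ 0 := by rintro rfl; simp at h
  have h0 : derivationDegree δ a ≠ 0 := fun h' => h (hδ.ker_of_degree_eq_zero h')
  obtain ⟨n, hn⟩ := Nat.exists_eq_succ_of_ne_zero h0
  obtain ⟨h1, h2⟩ := hδ.degree_spec ha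
  rw [hn] at h1 h2
  rw [derivationDegree_eq (a := δ a) (n := n) h1 h2, hn]

theorem derivationDegree_add_of_ker {a b : B} (hb : δ b = 0) (ha : derivationDegree δ a ≠ 0) :
    derivationDegree δ (a + b) = derivationDegree δ a := by
  have key : ∀ n, n ≠ 0 → δ^[n] (a + b) = δ^[n] a := by
    intro n hn
    rw [iterate_derivation_add, iterate_derivation_eq_zero_of_le (m := 1) (by omega) hb, add_zero]
  unfold derivationDegree at *
  by_cases hbdd : BddAbove {k : ℕ | δ^[k] a ≠ 0}
  · have hne : {k : ℕ | δ^[k] a ≠ 0}.Nonempty := by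
      by_contra h
      rw [Set.not_nonempty_iff_eq_empty] at h
      simp [h] at ha
    have hmem := Nat.sSup_mem hne hbdd
    refine IsGreatest.csSup_eq ⟨?_, fun j hj => ?_⟩
    · change δ^[_] (a + b) ≠ 0
      rw [key _ ha]
      exact hmem
    · by_cases h0 : j = 0
      · omega
      · refine le_csSup hbdd ?_
        change δ^[j] a ≠ 0
        rw [← key j h0]
        exact hj
  · exact absurd (Nat.sSup_of_not_bddAbove hbdd) ha

variable [IsDomain B]

theorem charZero_of_complex_algebra (B : Type*) [CommRing B] [Algebra ℂ B] [Nontrivial B] :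
    CharZero B :=
  charZero_of_injective_algebraMap (algebraMap ℂ B).injective

theorem IsLocallyNilpotent.degree_mul (hδ : IsLocallyNilpotent δ) {a b : B} (ha : a ≠ 0)
    (hb : b ≠ 0) :
    derivationDegree δ (a * b) = derivationDegree δ a + derivationDegree δ b := by
  have := charZero_of_complex_algebra B
  obtain ⟨ha0, ha1⟩ := hδ.degree_spec ha
  obtain ⟨hb0, hb1⟩ := hδ.degree_spec hb
  have key := iterate_derivation_mul _ _ _ a b rfl ha1 hb1
  refine derivationDegree_eq ?_ ?_
  · rw [key]
    refine mul_ne_zero ?_ (mul_ne_zero ha0 hb0)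
    exact_mod_cast (Nat.choose_pos (Nat.le_add_right _ _)).ne'
  · rw [Function.iterate_succ_apply', key, Derivation.leibniz, Derivation.leibniz,
      ← Function.iterate_succ_apply' (f := δ), ← Function.iterate_succ_apply' (f := δ), ha1, hb1]
    simp

theorem IsLocallyNilpotent.degree_pow (hδ : IsLocallyNilpotent δ) {a : B} (ha : a ≠ 0) (n : ℕ) :
    derivationDegree δ (a ^ n) = n * derivationDegree δ a := by
  induction n with
  | zero => simp [derivationDegree_eq_zero_of_ker]
  | succ n ih => rw [pow_succ, hδ.degree_mul (pow_ne_zero _ ha) ha, ih]; ring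

theorem IsLocallyNilpotent.degree_smul (hδ : IsLocallyNilpotent δ) {a : B} {c : ℂ} (hc : c ≠ 0)
    (ha : a ≠ 0) : derivationDegree δ (c • a) = derivationDegree δ a := by
  rw [Algebra.smul_def, hδ.degree_mul (by simpa using hc) ha,
    derivationDegree_eq_zero_of_ker (by simp), zero_add]

/-- An element that divides its image under a locally nilpotent derivation is in the kernel. -/
theorem IsLocallyNilpotent.eq_zero_of_dvd (hδ : IsLocallyNilpotent δ) {a : B} (h : a ∣ δ a) :
    δ a = 0 := by
  by_contra h0
  obtain ⟨b, hb⟩ := h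
  have ha : a ≠ 0 := by rintro rfl; simp at h0
  have hb0 : b ≠ 0 := by rintro rfl; simp [hb] at h0
  have h1 := hδ.degree_map_add_one h0
  rw [hb, hδ.degree_mul ha hb0] at h1
  omega

end LocallyNilpotent

/-! ### The algebra generated by `x, y, z` and `v_i = w ^ N_i / x ^ E_i` -/

section Modification

open MvPolynomial

/-- The exponent of `w = y ^ k - z ^ l` in `v_i = w ^ N_i / x ^ E_i`. -/
def wExp (n : ℕ → ℕ) : ℕ → ℕ
  | 0 => 1
  | i + 1 => n i * wExp n i

/-- The exponent of `x⁻¹` in `v_i = w ^ N_i / x ^ E_i`. -/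
def xExp (n : ℕ → ℕ) : ℕ → ℕ
  | 0 => 1
  | i + 1 => n i * xExp n i + 1

theorem wExp_succ_shift (n : ℕ → ℕ) (i : ℕ) :
    wExp n (i + 1) = n 0 * wExp (fun j => n (j + 1)) i := by
  induction i with
  | zero => rfl
  | succ i ih => rw [wExp, ih]; simp only [wExp]; ring

theorem wExp_pos {n : ℕ → ℕ} {i : ℕ} (hn : ∀ j < i, 0 < n j) : 0 < wExp n i := by
  induction i with
  | zero => exact one_pos
  | succ i ih => exact Nat.mul_pos (hn i (by omega)) (ih fun j hj => hn j (by omega))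

theorem xExp_pos (n : ℕ → ℕ) (i : ℕ) : 0 < xExp n i := by
  cases i <;> simp [xExp]

theorem xExp_le {n : ℕ → ℕ} {i : ℕ} (hn : ∀ j < i, 0 < n j) : xExp n i ≤ (i + 1) * wExp n i := by
  induction i with
  | zero => simp [xExp, wExp]
  | succ i ih =>
    have h1 := ih fun j hj => hn j (by omega)
    have h2 : 0 < wExp n (i + 1) := wExp_pos hn
    have h3 := Nat.mul_le_mul_left (n i) h1
    simp only [xExp, wExp] at *
    calc n i * xExp n i + 1 ≤ n i * ((i + 1) * wExp n i) + n i * wExp n i := by omega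
      _ = _ := by ring

/-- The slopes `E_i / N_i` are strictly increasing. -/
theorem xExp_mul_wExp_lt {n : ℕ → ℕ} {i j : ℕ} (hij : i < j) (hn : ∀ s < j, 0 < n s) :
    xExp n i * wExp n j < xExp n j * wExp n i := by
  induction j with
  | zero => omega
  | succ j ih =>
    have hi : 0 < wExp n i := wExp_pos fun s hs => hn s (by omega)
    have h1 : xExp n i * wExp n j ≤ xExp n j * wExp n i := by
      rcases Nat.lt_succ_iff_lt_or_eq.1 hij with h | rfl
      · exact (ih h fun s hs => hn s (by omega)).le
      · exact le_rfl
    have h3 := Nat.mul_le_mul_left (n j) h1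
    simp only [xExp, wExp]
    nlinarith

/-- Monomials `V f` in `v_0, …, v_r` (the digits of `f` in the mixed radix system with the radices
`n_i` are their exponents) that absorb each `v_i` up to a power of `x`. -/
theorem exists_radix_monomials {R : Type*} [CommRing R] (x : R) (r : ℕ) :
    ∀ (n : ℕ → ℕ) (v : ℕ → R), (∀ i < r, 0 < n i) → (∀ i < r, x * v (i + 1) = v i ^ n i) →
      ∃ V : ℕ → R, V 0 = 1 ∧ (∀ f, V f ∈ Submonoid.closure (v '' Set.Iic r)) ∧
        ∀ i ≤ r, ∀ f, ∃ c, v i * V f = x ^ c * V (f + wExp n i) := by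
  induction r with
  | zero =>
    intro n v _ _
    refine ⟨fun f => v 0 ^ f, pow_zero _, fun f => ?_, fun i hi f => ⟨0, ?_⟩⟩
    · exact Submonoid.pow_mem _ (Submonoid.subset_closure (Set.mem_image_of_mem v (by simp))) _
    · obtain rfl : i = 0 := by omega
      simp only [wExp]
      ring
  | succ r ih =>
    intro n v hn hv
    obtain ⟨V, hV0, hVm, hV⟩ := ih (fun j => n (j + 1)) (fun j => v (j + 1))
      (fun i hi => hn _ (by omega)) (fun i hi => hv _ (by omega))
    have hn0 := hn 0 (by omega)
    refine ⟨fun f => v 0 ^ (f % n 0) * V (f / n 0), by simp [hV0], fun f => ?_, ?_⟩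
    · refine Submonoid.mul_mem _ (Submonoid.pow_mem _
        (Submonoid.subset_closure (Set.mem_image_of_mem v (by simp))) _) ?_
      refine Submonoid.closure_mono ?_ (hVm _)
      rintro _ ⟨j, hj, rfl⟩
      exact ⟨j + 1, by simpa using hj, rfl⟩
    · rintro (_ | i) hi f
      · by_cases h : f % n 0 + 1 < n 0
        · refine ⟨0, ?_⟩
          have hd := Nat.div_add_mod f (n 0)
          have h1 : (f + 1) % n 0 = f % n 0 + 1 := by
            rw [Nat.add_mod, Nat.mod_eq_of_lt (a := 1) (by omega), Nat.mod_eq_of_lt h]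
          have h2 : (f + 1) / n 0 = f / n 0 := by
            rw [Nat.succ_div, if_neg, add_zero]
            intro hd
            rw [Nat.dvd_iff_mod_eq_zero, h1] at hd
            omega
          simp only [wExp, h1, h2]
          ring
        · have hlt := Nat.mod_lt f hn0
          have h0 : f % n 0 + 1 = n 0 := by omega
          have hdvd : n 0 ∣ f + 1 := by
            rw [Nat.dvd_iff_mod_eq_zero]
            conv_lhs => rw [← Nat.div_add_mod f (n 0), add_assoc, h0]
            simp
          have h1 : (f + 1) % n 0 = 0 := Nat.eq_zero_of_dvd_of_lt
            ((Nat.dvd_mod_iff dvd_rfl).2 hdvd) (Nat.mod_lt _ hn0)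
          have h2 : (f + 1) / n 0 = f / n 0 + 1 := by rw [Nat.succ_div, if_pos hdvd]
          obtain ⟨c, hc⟩ := hV 0 (by omega) (f / n 0)
          refine ⟨c + 1, ?_⟩
          simp only [wExp, zero_add] at hc
          simp only [wExp, h1, h2, pow_zero, one_mul]
          have h3 : v 0 * v 0 ^ (f % n 0) = x * v 1 := by
            rw [← pow_succ', h0, hv 0 (by omega)]
          rw [← mul_assoc, h3, mul_assoc, hc]
          ring
      · obtain ⟨c, hc⟩ := hV i (by omega) (f / n 0)
        refine ⟨c, ?_⟩
        simp only [wExp_succ_shift]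
        rw [Nat.add_mul_mod_self_left, Nat.add_mul_div_left _ _ hn0]
        linear_combination v 0 ^ (f % n 0) * hc

/-- The algebra generated by `x, y, z` and `v_0, …, v_{m-1}`, where
`x * v_0 = y ^ k - z ^ l` and `x * v_{i+1} = v_i ^ n_i`, and in which `x, y, z` can be
specialised to arbitrary complex numbers with `x ≠ 0`. -/
structure IsModification (k l m : ℕ) (n : ℕ → ℕ) {R : Type*} [CommRing R] [Algebra ℂ R]
    (x y z : R) (v : ℕ → R) : Prop where
  two_le_k : 2 ≤ k
  two_le_l : 2 ≤ l
  coprime : k.Coprime l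
  m_pos : 0 < m
  n_pos : ∀ i, i + 1 < m → 0 < n i
  rel_zero : x * v 0 = y ^ k - z ^ l
  rel_succ : ∀ i, i + 1 < m → x * v (i + 1) = v i ^ n i
  adjoin_eq_top : Algebra.adjoin ℂ ({x, y, z} ∪ v '' Set.Iio m) = ⊤
  exists_point : ∀ a b c : ℂ, a ≠ 0 → ∃ φ : R →ₐ[ℂ] ℂ, φ x = a ∧ φ y = b ∧ φ z = c

/-- The monomials in `x, y, z, v_i`, together with their bidegree: the exponent of `x` and the
weight in `y, z`, of weights `l, k`, when they are written in `ℂ[x, x⁻¹, y, z]`. -/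
inductive IsBihomMonomial (k l m : ℕ) (n : ℕ → ℕ) {R : Type*} [CommRing R]
    (x y z : R) (v : ℕ → R) : ℤ → ℕ → R → Prop
  | one : IsBihomMonomial k l m n x y z v 0 0 1
  | mul_x {g τ r} : IsBihomMonomial k l m n x y z v g τ r →
      IsBihomMonomial k l m n x y z v (g + 1) τ (x * r)
  | mul_y {g τ r} : IsBihomMonomial k l m n x y z v g τ r →
      IsBihomMonomial k l m n x y z v g (τ + l) (y * r)
  | mul_z {g τ r} : IsBihomMonomial k l m n x y z v g τ r →
      IsBihomMonomial k l m n x y z v g (τ + k) (z * r)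
  | mul_v {g τ r} (i : ℕ) (hi : i < m) : IsBihomMonomial k l m n x y z v g τ r →
      IsBihomMonomial k l m n x y z v (g - xExp n i) (τ + k * l * wExp n i) (v i * r)

namespace IsModification

variable {k l m : ℕ} {n : ℕ → ℕ} {R : Type*} [CommRing R] [Algebra ℂ R] {x y z : R} {v : ℕ → R}

theorem nontrivial (h : IsModification k l m n x y z v) : Nontrivial R := by
  obtain ⟨φ, -⟩ := h.exists_point 1 0 0 one_ne_zero
  exact φ.toRingHom.domain_nontrivial

theorem x_pow_mul_v (h : IsModification k l m n x y z v) {i : ℕ} (hi : i < m) :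
    x ^ xExp n i * v i = (y ^ k - z ^ l) ^ wExp n i := by
  induction i with
  | zero => simpa [xExp, wExp] using h.rel_zero
  | succ i ih =>
    have h1 := h.rel_succ i hi
    simp only [xExp, wExp]
    rw [mul_comm (n i) (wExp n i), pow_mul, ← ih (by omega), mul_pow, ← h1]
    ring

/-- The monomials `V f` of `exists_radix_monomials`, with the exponents `ε f` such that
`V f = w ^ f / x ^ ε f`. -/
theorem exists_monomials (h : IsModification k l m n x y z v) :
    ∃ (V : ℕ → R) (ε : ℕ → ℕ), V 0 = 1 ∧ ε 0 = 0 ∧ StrictMono ε ∧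
      (∀ f, V f ∈ Submonoid.closure (v '' Set.Iio m)) ∧
      (∀ f j, (y ^ k - z ^ l) ^ j * V f = x ^ (ε (f + j) - ε f) * V (f + j)) ∧
      ∀ i < m, ∀ f, ∃ c, v i * V f = x ^ c * V (f + wExp n i) ∧
        c + ε f + xExp n i = ε (f + wExp n i) := by
  have hm := h.m_pos
  obtain ⟨V, hV0, hVm, hV⟩ := exists_radix_monomials x (m - 1) n v
    (fun i hi => h.n_pos i (by omega)) (fun i hi => h.rel_succ i (by omega))
  choose c hc using hV 0 (by omega)
  simp only [wExp] at hc
  let ε : ℕ → ℕ := fun f => ∑ j ∈ Finset.range f, (1 + c j)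
  have hε : ∀ f, ε (f + 1) = ε f + (1 + c f) := fun f => Finset.sum_range_succ _ _
  have hmono : StrictMono ε := strictMono_nat_of_lt_succ fun f => by rw [hε]; omega
  have hw : ∀ f j, (y ^ k - z ^ l) ^ j * V f = x ^ (ε (f + j) - ε f) * V (f + j) := by
    intro f j
    induction j with
    | zero => simp
    | succ j ih =>
      have h1 : ε (f + (j + 1)) - ε f = (ε (f + j) - ε f) + (1 + c (f + j)) := by
        have := hmono.monotone (Nat.le_add_right f j)
        rw [← add_assoc, hε]
        omega
      rw [pow_succ', mul_assoc, ih, h1, ← h.rel_zero, ← add_assoc f j 1]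
      linear_combination x ^ (ε (f + j) - ε f) * x * hc (f + j)
  refine ⟨V, ε, hV0, by simp [ε], hmono, fun f => ?_, hw, fun i hi f => ?_⟩
  · refine Submonoid.closure_mono (Set.image_mono fun j hj => ?_) (hVm f)
    simp only [Set.mem_Iic, Set.mem_Iio] at *
    omega
  · obtain ⟨d, hd⟩ := hV i (by omega) f
    refine ⟨d, hd, ?_⟩
    -- The exponents of `x` are compared at a point with `x = 2` and `w = 1`.
    obtain ⟨φ, hx, hy, hz⟩ := h.exists_point 2 1 0 two_ne_zero
    have hl := h.two_le_l
    have hφw : φ (y ^ k - z ^ l) = 1 := by simp [hy, hz, show l ≠ 0 by omega]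
    have hφv : (2 : ℂ) ^ xExp n i * φ (v i) = 1 := by
      have := congrArg φ (h.x_pow_mul_v hi)
      rwa [map_mul, map_pow, map_pow, hφw, one_pow, hx] at this
    have hφV : ∀ f, (2 : ℂ) ^ ε f * φ (V f) = 1 := fun f => by
      have := congrArg φ (hw 0 f)
      rw [map_mul, map_mul, map_pow, map_pow, hφw, hx, hV0, zero_add] at this
      simpa [ε] using this.symm
    have hφd := congrArg φ hd
    rw [map_mul, map_mul, map_pow, hx] at hφd
    have key : (2 : ℂ) ^ (d + ε f + xExp n i) = 2 ^ ε (f + wExp n i) := by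
      calc (2 : ℂ) ^ (d + ε f + xExp n i)
          = 2 ^ (ε f + xExp n i) * 2 ^ d * (2 ^ ε (f + wExp n i) * φ (V (f + wExp n i))) := by
            rw [hφV]; ring
        _ = 2 ^ ε (f + wExp n i) * (2 ^ xExp n i * φ (v i)) * (2 ^ ε f * φ (V f)) := by
            linear_combination -2 ^ (ε f + xExp n i + ε (f + wExp n i)) * hφd
        _ = _ := by rw [hφv, hφV]; ring
    exact Nat.pow_right_injective le_rfl (by exact_mod_cast key)

/-- The graded pieces `M g * ℂ[y, z]` for the degree in `x`, where `M g = x ^ g * w ^ β g` has the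
least possible exponent of `w`. -/
theorem exists_leading_monomials (h : IsModification k l m n x y z v) :
    ∃ (M : ℤ → R) (β : ℤ → ℕ), (∀ g < 0, 0 < β g) ∧
      (∀ g, M g ∈ Submonoid.closure ({x} ∪ v '' Set.Iio m)) ∧
      (∀ (g : ℤ) (T s : ℕ), T + g = s → x ^ T * M g = x ^ s * (y ^ k - z ^ l) ^ β g) ∧
      ∀ g τ r, IsBihomMonomial k l m n x y z v g τ r → ∃ j b c,
        r = M g * ((y ^ k - z ^ l) ^ j * y ^ b * z ^ c) ∧
        k * l * (β g + j) + l * b + k * c = τ := by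
  obtain ⟨V, ε, hV0, hε0, hmono, hVm, hw, hv⟩ := h.exists_monomials
  have hex : ∀ g : ℤ, ∃ f, -g ≤ ε f := fun g =>
    ⟨g.natAbs, by have := hmono.le_apply (x := g.natAbs); omega⟩
  classical
  let β : ℤ → ℕ := fun g => Nat.find (hex g)
  have hβ : ∀ g, -g ≤ ε (β g) := fun g => Nat.find_spec (hex g)
  refine ⟨fun g => x ^ (g + ε (β g)).toNat * V (β g), β, fun g hg => ?_, fun g => ?_, ?_, ?_⟩
  · by_contra h0
    have := hβ g
    rw [show β g = 0 by omega, hε0] at this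
    omega
  · refine Submonoid.mul_mem _ (Submonoid.pow_mem _ (Submonoid.subset_closure (by simp)) _) ?_
    exact Submonoid.closure_mono Set.subset_union_right (hVm _)
  · intro g T s hs
    have h1 := hw 0 (β g)
    rw [hV0, mul_one, zero_add, hε0, Nat.sub_zero] at h1
    have h2 : T + (g + ε (β g)).toNat = s + ε (β g) := by have := hβ g; omega
    rw [h1, ← mul_assoc, ← pow_add, h2]
    ring
  · intro g τ r hr
    have key : ∃ a f b c : ℕ, r = x ^ a * V f * (y ^ b * z ^ c) ∧ (a : ℤ) - ε f = g ∧
        k * l * f + l * b + k * c = τ := by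
      induction hr with
      | one => exact ⟨0, 0, 0, 0, by simp [hV0], by simp [hε0], by simp⟩
      | mul_x _ ih =>
        obtain ⟨a, f, b, c, rfl, h1, h2⟩ := ih
        exact ⟨a + 1, f, b, c, by ring, by push_cast; omega, h2⟩
      | mul_y _ ih =>
        obtain ⟨a, f, b, c, rfl, h1, h2⟩ := ih
        exact ⟨a, f, b + 1, c, by ring, h1, by rw [← h2]; ring⟩
      | mul_z _ ih =>
        obtain ⟨a, f, b, c, rfl, h1, h2⟩ := ih
        exact ⟨a, f, b, c + 1, by ring, h1, by rw [← h2]; ring⟩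
      | mul_v i hi _ ih =>
        obtain ⟨a, f, b, c, rfl, h1, h2⟩ := ih
        obtain ⟨d, hd, hd'⟩ := hv i hi f
        refine ⟨a + d, f + wExp n i, b, c, ?_, by push_cast; omega, by rw [← h2]; ring⟩
        linear_combination x ^ a * (y ^ b * z ^ c) * hd
    obtain ⟨a, f, b, c, rfl, h1, h2⟩ := key
    have hle : β g ≤ f := Nat.find_min' (hex g) (by omega)
    obtain ⟨j, rfl⟩ := Nat.exists_eq_add_of_le hle
    refine ⟨j, b, c, ?_, h2⟩
    have h3 := hw (β g) j
    have h4 : a = (g + ε (β g)).toNat + (ε (β g + j) - ε (β g)) := by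
      have := hβ g
      have := hmono.monotone (Nat.le_add_right (β g) j)
      omega
    rw [h4, pow_add]
    linear_combination -x ^ (g + ε (β g)).toNat * y ^ b * z ^ c * h3

end IsModification

end Modification

/-! ### Embedding into `ℂ[x, x⁻¹, y, z]` -/

section PolynomialSubalgebra

open MvPolynomial

/-- The value at `(y, z)` of a polynomial in two variables. -/
noncomputable def evalYZ {R : Type*} [CommRing R] [Algebra ℂ R] (y z : R) :
    MvPolynomial (Fin 2) ℂ →ₐ[ℂ] R :=
  aeval ![y, z]

@[simp]
theorem evalYZ_X_zero {R : Type*} [CommRing R] [Algebra ℂ R] (y z : R) :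
    evalYZ y z (X 0) = y := by simp [evalYZ]

@[simp]
theorem evalYZ_X_one {R : Type*} [CommRing R] [Algebra ℂ R] (y z : R) :
    evalYZ y z (X 1) = z := by simp [evalYZ]

/-- The value at `(x, y, z)` of a polynomial over `ℂ[y, z]`. -/
noncomputable def evalXYZ {R : Type*} [CommRing R] [Algebra ℂ R] (x y z : R) :
    Polynomial (MvPolynomial (Fin 2) ℂ) →+* R :=
  Polynomial.eval₂RingHom (evalYZ y z).toRingHom x

@[simp]
theorem evalXYZ_X {R : Type*} [CommRing R] [Algebra ℂ R] (x y z : R) :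
    evalXYZ x y z Polynomial.X = x := by simp [evalXYZ]

@[simp]
theorem evalXYZ_C {R : Type*} [CommRing R] [Algebra ℂ R] (x y z : R) (h : MvPolynomial (Fin 2) ℂ) :
    evalXYZ x y z (Polynomial.C h) = evalYZ y z h := by simp [evalXYZ]

/-- The polynomial `y ^ k - c * z ^ l`. -/
noncomputable def cuspPoly (k l : ℕ) (c : ℂ) : MvPolynomial (Fin 2) ℂ := X 0 ^ k - C c * X 1 ^ l

theorem evalYZ_cuspPoly {R : Type*} [CommRing R] [Algebra ℂ R] (y z : R) (k l : ℕ) (c : ℂ) :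
    evalYZ y z (cuspPoly k l c) = y ^ k - c • z ^ l := by
  simp [cuspPoly, evalYZ, Algebra.smul_def]

theorem cuspPoly_one_ne_zero {k l : ℕ} (hl : 0 < l) : cuspPoly k l 1 ≠ 0 := by
  intro h
  have := congrArg (eval ![1, 0]) h
  simp [cuspPoly, hl.ne'] at this

theorem exists_isBihomMonomial (k l : ℕ) (n : ℕ → ℕ) {m : ℕ} {R : Type*} [CommRing R] {x y z : R}
    {v : ℕ → R} {s : R} (hs : s ∈ Submonoid.closure ({x, y, z} ∪ v '' Set.Iio m)) :
    ∃ g τ, IsBihomMonomial k l m n x y z v g τ s := by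
  induction hs using Submonoid.closure_induction_left with
  | one => exact ⟨_, _, .one⟩
  | mul_left a ha b _ ih =>
    obtain ⟨g, τ, ih⟩ := ih
    rcases ha with (rfl | rfl | rfl) | ⟨i, hi, rfl⟩
    exacts [⟨_, _, .mul_x ih⟩, ⟨_, _, .mul_y ih⟩, ⟨_, _, .mul_z ih⟩, ⟨_, _, .mul_v i hi ih⟩]

namespace IsModification

variable {k l m : ℕ} {n : ℕ → ℕ} {R : Type*} [CommRing R] [Algebra ℂ R] {x y z : R} {v : ℕ → R}

theorem evalXYZ_injective (h : IsModification k l m n x y z v) :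
    Function.Injective (evalXYZ x y z) := by
  rw [injective_iff_map_eq_zero]
  intro Q hQ
  ext1 s
  refine MvPolynomial.funext fun p => ?_
  have hzero : Q.map (eval p) = 0 := by
    refine Polynomial.eq_zero_of_infinite_isRoot _ ?_
    refine Set.Infinite.mono (s := {0}ᶜ) (fun a ha => ?_)
      (Set.Finite.infinite_compl (Set.finite_singleton 0))
    obtain ⟨φ, hx, hy, hz⟩ := h.exists_point a (p 0) (p 1) ha
    have h1 := congrArg φ hQ
    have h2 : (φ.comp (evalYZ y z)).toRingHom = eval p := by
      refine MvPolynomial.ringHom_ext (fun c => ?_) (fun i => ?_)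
      · simp [evalYZ]
      · fin_cases i <;> simp [evalYZ, hy, hz]
    have h3 : φ (evalXYZ x y z Q) = Q.eval₂ (eval p) a := by
      rw [evalXYZ, Polynomial.coe_eval₂RingHom, ← h2, ← hx]
      exact Polynomial.hom_eval₂ Q _ φ.toRingHom x
    rw [h3, map_zero] at h1
    rw [Set.mem_ofPred_eq, Polynomial.IsRoot, Polynomial.eval_map, h1]
  have := congrArg (fun P => Polynomial.coeff P s) hzero
  simpa using this

/-- After multiplication by a power of `x`, every element becomes a polynomial in `x, y, z`; its
coefficients that correspond to negative powers of `x` are divisible by `y ^ k - z ^ l`. -/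
theorem exists_pow_mul_eq (h : IsModification k l m n x y z v) (r : R) :
    ∃ (T : ℕ) (Q : Polynomial (MvPolynomial (Fin 2) ℂ)), x ^ T * r = evalXYZ x y z Q ∧
      (∀ s < T, cuspPoly k l 1 ∣ Q.coeff s) ∧ (Q = 0 → r = 0) := by
  classical
  have hk := h.two_le_k
  have hl := h.two_le_l
  obtain ⟨M, β, hβ, -, hM, hmon⟩ := h.exists_leading_monomials
  let W : ℤ → Submodule ℂ R := fun g =>
    (evalYZ y z).toLinearMap.range.map (LinearMap.mulLeft ℂ (M g))
  have hr : r ∈ ⨆ g, W g := by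
    have hr : r ∈ Subalgebra.toSubmodule (Algebra.adjoin ℂ ({x, y, z} ∪ v '' Set.Iio m)) := by
      rw [h.adjoin_eq_top]; trivial
    rw [Algebra.adjoin_eq_span] at hr
    refine Submodule.span_le.2 (fun s hs => ?_) hr
    obtain ⟨g, τ, hs⟩ := exists_isBihomMonomial k l n hs
    obtain ⟨j, b, c, rfl, -⟩ := hmon g τ s hs
    refine Submodule.mem_iSup_of_mem g ⟨_, ⟨cuspPoly k l 1 ^ j * X 0 ^ b * X 1 ^ c, rfl⟩, ?_⟩
    simp [evalYZ_cuspPoly]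
  obtain ⟨f, hf, rfl⟩ := (Submodule.mem_iSup_iff_exists_finsupp W r).1 hr
  have hf' : ∀ g, ∃ H, M g * evalYZ y z H = f g := fun g => by
    obtain ⟨_, ⟨H, rfl⟩, hH⟩ := hf g
    exact ⟨H, hH⟩
  choose H hH using hf'
  let T := f.support.sup Int.natAbs
  have hT : ∀ g ∈ f.support, 0 ≤ T + g := fun g hg => by
    have : g.natAbs ≤ T := Finset.le_sup (f := Int.natAbs) hg
    omega
  let Q : Polynomial (MvPolynomial (Fin 2) ℂ) :=
    ∑ g ∈ f.support, Polynomial.X ^ (T + g).toNat * Polynomial.C (cuspPoly k l 1 ^ β g * H g)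
  have hQ : ∀ s, Q.coeff s =
      ∑ g ∈ f.support, if s = (T + g).toNat then cuspPoly k l 1 ^ β g * H g else 0 := by
    intro s
    simp only [Q, Polynomial.finsetSum_coeff, Polynomial.coeff_X_pow_mul', Polynomial.coeff_C]
    refine Finset.sum_congr rfl fun g _ => ?_
    split_ifs <;> first | rfl | omega
  refine ⟨T, Q, ?_, fun s hs => ?_, fun hQ0 => ?_⟩
  · rw [Finsupp.sum, Finset.mul_sum, map_sum]
    refine Finset.sum_congr rfl fun g hg => ?_
    rw [← hH g, ← mul_assoc, hM g T (T + g).toNat (by have := hT g hg; omega)]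
    simp [evalYZ_cuspPoly, mul_assoc]
  · rw [hQ]
    refine Finset.dvd_sum fun g hg => ?_
    split_ifs with h0
    · have := hT g hg
      exact Dvd.dvd.mul_right (dvd_pow_self _ (hβ g (by omega)).ne') _
    · exact dvd_zero _
  · refine Finset.sum_eq_zero fun g hg => ?_
    have h1 := hQ (T + g).toNat
    rw [Finset.sum_eq_single_of_mem g hg, if_pos rfl, hQ0, Polynomial.coeff_zero] at h1
    · have h2 := (mul_eq_zero.1 h1.symm).resolve_left
        (pow_ne_zero _ (cuspPoly_one_ne_zero (by omega)))
      rw [← hH g, h2, map_zero, mul_zero]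
    · intro g' hg' hne
      have := hT g hg
      have := hT g' hg'
      exact if_neg (by omega)

theorem isDomain (h : IsModification k l m n x y z v) : IsDomain R := by
  have := h.nontrivial
  have : NoZeroDivisors R := by
    refine ⟨fun {r s} hrs => ?_⟩
    obtain ⟨T, Q, h1, -, h2⟩ := h.exists_pow_mul_eq r
    obtain ⟨T', Q', h1', -, h2'⟩ := h.exists_pow_mul_eq s
    have h3 : evalXYZ x y z (Q * Q') = 0 := by
      rw [map_mul, ← h1, ← h1']
      linear_combination x ^ T * x ^ T' * hrs
    rcases mul_eq_zero.1 ((map_eq_zero_iff _ h.evalXYZ_injective).1 h3) with h4 | h4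
    exacts [.inl (h2 h4), .inr (h2' h4)]
  exact NoZeroDivisors.to_isDomain R

theorem not_isUnit_of_point {r : R} (φ : R →ₐ[ℂ] ℂ) (hr : φ r = 0) : ¬ IsUnit r := fun hu => by
  simpa [hr] using hu.map φ

theorem not_isUnit_x (h : IsModification k l m n x y z v) : ¬ IsUnit x := by
  have hk := h.two_le_k
  have hl := h.two_le_l
  rintro ⟨u, rfl⟩
  obtain ⟨T, Q, h1, h2, -⟩ := h.exists_pow_mul_eq (↑u⁻¹ : R)
  -- The element `x⁻¹` would correspond to the coefficient `1` of `x⁻¹`.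
  have h3 : evalXYZ (u : R) y z (Polynomial.X * Q) = evalXYZ (u : R) y z (Polynomial.X ^ T) := by
    rw [map_mul, ← h1, map_pow, evalXYZ_X]
    linear_combination (u : R) ^ T * u.mul_inv
  have h4 := h.evalXYZ_injective h3
  have h5 : cuspPoly k l 1 ∣ (1 : MvPolynomial (Fin 2) ℂ) := by
    rcases T with _ | T
    · have := congrArg (fun P => Polynomial.coeff P 0) h4
      simp at this
    · have := congrArg (fun P => Polynomial.coeff P (T + 1)) h4
      simp only [Polynomial.coeff_X_mul, Polynomial.coeff_X_pow_self] at this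
      rw [← this]
      exact h2 T (by omega)
  obtain ⟨q, hq⟩ := h5
  have := congrArg (eval ![0, 0]) hq
  simp [cuspPoly, show k ≠ 0 by omega, show l ≠ 0 by omega] at this

theorem not_isUnit_v (h : IsModification k l m n x y z v) {i : ℕ} (hi : i < m) :
    ¬ IsUnit (v i) := by
  have hk := h.two_le_k
  have hl := h.two_le_l
  obtain ⟨φ, hx, hy, hz⟩ := h.exists_point 1 0 0 one_ne_zero
  refine not_isUnit_of_point φ ?_
  have hN : wExp n i ≠ 0 := (wExp_pos fun j hj => h.n_pos j (by omega)).ne'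
  have := congrArg φ (h.x_pow_mul_v hi)
  simpa [hx, hy, hz, show k ≠ 0 by omega, show l ≠ 0 by omega, hN] using this

end IsModification

end PolynomialSubalgebra

/-! ### Irreducible homogeneous elements -/

section Factorization

open MvPolynomial

/-- The factors of the weighted homogeneous polynomials in two variables of weights `l` and `k`: the
variables and the binomials `y ^ k - c * z ^ l`, which include `y ^ k`. -/
def cuspFactors (k l : ℕ) : Set (MvPolynomial (Fin 2) ℂ) :=
  {X 0, X 1} ∪ Set.range (cuspPoly k l)

theorem aeval_homogenize_prod_mem (k l : ℕ) (s : Multiset ℂ) :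
    ∀ D, s.card ≤ D → aeval ![(X 0 ^ k : MvPolynomial (Fin 2) ℂ), X 1 ^ l]
      (((s.map fun c => Polynomial.X - Polynomial.C c).prod).homogenize D) ∈
        Submonoid.closure (cuspFactors k l) := by
  induction s using Multiset.induction with
  | empty =>
    intro D _
    simp only [Multiset.map_zero, Multiset.prod_zero, Polynomial.homogenize_one, map_pow, aeval_X,
      Matrix.cons_val_one, Matrix.cons_val_fin_one]
    exact Submonoid.pow_mem _ (Submonoid.pow_mem _
      (Submonoid.subset_closure (by simp [cuspFactors])) _) _
  | cons c s ih =>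
    intro D hD
    rw [Multiset.card_cons] at hD
    obtain ⟨D, rfl⟩ := Nat.exists_eq_add_of_le' (show 1 ≤ D by omega)
    rw [Multiset.map_cons, Multiset.prod_cons, add_comm D 1, Polynomial.homogenize_mul, map_mul]
    · refine Submonoid.mul_mem _ (Submonoid.subset_closure (.inr ⟨c, ?_⟩)) (ih D (by omega))
      simp [Polynomial.homogenize_sub, Polynomial.homogenize_X, cuspPoly]
    · exact (Polynomial.natDegree_X_sub_C c).le
    · rw [Polynomial.natDegree_multiset_prod_X_sub_C_eq_card]; omega

/-- Over `ℂ`, a weighted homogeneous polynomial in two variables with coprime weights is a product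
of the variables and of binomials. -/
theorem exists_factorization {k l : ℕ} (hk : 0 < k) (hl : 0 < l) (hkl : k.Coprime l)
    {h : MvPolynomial (Fin 2) ℂ} {τ : ℕ} (hh : IsWeightedHomogeneous ![l, k] h τ) (h0 : h ≠ 0) :
    ∃ α : ℂ, ∃ s ∈ Submonoid.closure (cuspFactors k l), h = C α * s := by
  classical
  have hτ : ∀ μ ∈ h.support, l * μ 0 + k * μ 1 = τ := fun μ hμ => by
    have := hh (mem_support_iff.1 hμ)
    rw [Finsupp.weight_apply, Finsupp.sum_fintype _ _ (by simp)] at this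
    simpa [mul_comm] using this
  obtain ⟨ν, hν⟩ := support_nonempty.2 h0
  -- The exponents are `(b + k * j, c + l * (D - j))` with `j ≤ D`.
  obtain ⟨b, hb⟩ : ∃ b, b = ν 0 % k := ⟨_, rfl⟩
  obtain ⟨c, hc⟩ : ∃ c, c = ν 1 % l := ⟨_, rfl⟩
  obtain ⟨D, hD⟩ : ∃ D, D = ν 0 / k + ν 1 / l := ⟨_, rfl⟩
  have hsupp : ∀ μ ∈ h.support, μ 0 = b + k * (μ 0 / k) ∧ μ 0 / k ≤ D ∧
      μ 1 = c + l * (D - μ 0 / k) := by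
    intro μ hμ
    have h1 : l * μ 0 + k * μ 1 = l * ν 0 + k * ν 1 := by rw [hτ μ hμ, hτ ν hν]
    have h2 : μ 0 ≡ ν 0 [MOD k] := by
      refine Nat.ModEq.cancel_left_of_coprime hkl (c := l) ?_
      have : l * μ 0 + k * μ 1 ≡ l * ν 0 + k * ν 1 [MOD k] := by rw [h1]
      simpa [Nat.ModEq] using this
    have h3 : μ 1 ≡ ν 1 [MOD l] := by
      refine Nat.ModEq.cancel_left_of_coprime hkl.symm (c := k) ?_
      have : l * μ 0 + k * μ 1 ≡ l * ν 0 + k * ν 1 [MOD l] := by rw [h1]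
      simpa [Nat.ModEq] using this
    have h4 := Nat.mod_add_div (μ 0) k
    have h5 := Nat.mod_add_div (μ 1) l
    have h6 := Nat.mod_add_div (ν 0) k
    have h7 := Nat.mod_add_div (ν 1) l
    rw [h2, ← hb] at h4
    rw [h3, ← hc] at h5
    rw [← hb] at h6
    rw [← hc] at h7
    have h8 : μ 0 / k + μ 1 / l = D := by
      rw [hD]
      refine Nat.eq_of_mul_eq_mul_left (Nat.mul_pos hk hl) ?_
      rw [← h4, ← h5, ← h6, ← h7] at h1
      nlinarith
    refine ⟨h4.symm, h8 ▸ Nat.le_add_right _ _, ?_⟩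
    rw [← h8, Nat.add_sub_cancel_left, h5]
  let p : Polynomial ℂ :=
    ∑ μ ∈ h.support, Polynomial.C (coeff μ h) * Polynomial.X ^ (μ 0 / k)
  have hp : p.natDegree ≤ D := Polynomial.natDegree_sum_le_of_forall_le _ _ fun μ hμ =>
    (Polynomial.natDegree_C_mul_X_pow_le _ _).trans (hsupp μ hμ).2.1
  have hhp : h = X 0 ^ b * X 1 ^ c *
      aeval ![(X 0 ^ k : MvPolynomial (Fin 2) ℂ), X 1 ^ l] (p.homogenize D) := by
    simp only [p, Polynomial.homogenize_finsetSum, Polynomial.homogenize_C_mul, map_sum, map_mul,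
      Finset.mul_sum]
    conv_lhs => rw [as_sum h]
    refine Finset.sum_congr rfl fun μ hμ => ?_
    obtain ⟨h1, h2, h3⟩ := hsupp μ hμ
    generalize μ 0 / k = j at h1 h2 h3 ⊢
    rw [Polynomial.homogenize_X_pow h2, monomial_eq, Finsupp.prod_fintype _ _ (by simp)]
    simp only [Fin.prod_univ_two, map_mul, map_pow, aeval_X, algHom_C, algebraMap_eq,
      Matrix.cons_val_zero, Matrix.cons_val_one, Matrix.cons_val_fin_one]
    rw [h3]
    conv_lhs => rw [h1]
    ring
  have hsplit := (IsAlgClosed.splits p).eq_prod_roots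
  refine ⟨p.leadingCoeff, X 0 ^ b * X 1 ^ c * aeval ![(X 0 ^ k : MvPolynomial (Fin 2) ℂ), X 1 ^ l]
      (((p.roots.map fun c => Polynomial.X - Polynomial.C c).prod).homogenize D), ?_, ?_⟩
  · refine Submonoid.mul_mem _ (Submonoid.mul_mem _ (Submonoid.pow_mem _ ?_ _)
      (Submonoid.pow_mem _ ?_ _)) (aeval_homogenize_prod_mem k l _ D
        ((Polynomial.card_roots' p).trans hp))
    all_goals exact Submonoid.subset_closure (by simp [cuspFactors])
  · conv_lhs => rw [hhp, hsplit, Polynomial.homogenize_C_mul]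
    simp only [map_mul, algHom_C, algebraMap_eq]
    ring

/-- An irreducible element that is a scalar multiple of a product of nonunits is a scalar multiple
of one of them. -/
theorem Irreducible.exists_eq_smul {R : Type*} [CommRing R] [Algebra ℂ R] {S : Set R}
    (hS : ∀ s ∈ S, ¬ IsUnit s) {r s : R} (hr : Irreducible r) {α : ℂ}
    (hs : s ∈ Submonoid.closure S) (hrs : r = α • s) : ∃ s ∈ S, r = α • s := by
  have hα : α ≠ 0 := by rintro rfl; exact hr.ne_zero (by simpa using hrs)
  have hs' : Irreducible s := by
    rw [hrs, Algebra.smul_def] at hr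
    exact (irreducible_isUnit_mul ((IsUnit.mk0 α hα).map (algebraMap ℂ R))).1 hr
  suffices s ∈ S from ⟨s, this, hrs⟩
  clear hrs hr
  obtain ⟨L, hL, rfl⟩ := Submonoid.exists_list_of_mem_closure hs
  rcases L with _ | ⟨a, L⟩
  · simp at hs'
  · rw [List.prod_cons] at hs' ⊢
    have hu := (hs'.isUnit_or_isUnit rfl).resolve_left (hS a (hL a (by simp)))
    rcases L with _ | ⟨b, L⟩
    · simpa using hL a (by simp)
    · rw [List.prod_cons] at hu
      exact absurd (isUnit_of_mul_isUnit_left hu) (hS b (hL b (by simp)))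

namespace IsModification

variable {k l m : ℕ} {n : ℕ → ℕ} {R : Type*} [CommRing R] [Algebra ℂ R] {x y z : R} {v : ℕ → R}

/-- The elements `x, y, z, v_i` and `y ^ k - c z ^ l` with `c ≠ 0, 1`; for `c = 1` the last one is
`x * v_0`. -/
def primitives (k l m : ℕ) (x y z : R) (v : ℕ → R) : Set R :=
  {x, y, z} ∪ v '' Set.Iio m ∪ {r | ∃ c : ℂ, c ≠ 0 ∧ c ≠ 1 ∧ r = y ^ k - c • z ^ l}

theorem primitives_cases {s : R} (hs : s ∈ primitives k l m x y z v) :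
    s = x ∨ (∃ i < m, s = v i) ∨ ((∃ H, s = evalYZ y z H) ∧
      (s = y ∨ s = z ∨ ∃ c : ℂ, c ≠ 0 ∧ c ≠ 1 ∧ s = y ^ k - c • z ^ l)) := by
  rcases hs with ((rfl | rfl | rfl) | ⟨i, hi, rfl⟩) | ⟨c, hc0, hc1, rfl⟩
  · exact .inl rfl
  · exact .inr (.inr ⟨⟨X 0, by simp⟩, .inl rfl⟩)
  · exact .inr (.inr ⟨⟨X 1, by simp⟩, .inr (.inl rfl)⟩)
  · exact .inr (.inl ⟨i, hi, rfl⟩)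
  · exact .inr (.inr ⟨⟨cuspPoly k l c, (evalYZ_cuspPoly y z k l c).symm⟩,
      .inr (.inr ⟨c, hc0, hc1, rfl⟩)⟩)

theorem not_isUnit_of_mem_primitives (h : IsModification k l m n x y z v) {r : R}
    (hr : r ∈ primitives k l m x y z v) : ¬ IsUnit r := by
  have hk := h.two_le_k
  have hl := h.two_le_l
  obtain ⟨φ, -, hy, hz⟩ := h.exists_point 1 0 0 one_ne_zero
  rcases hr with ((rfl | rfl | rfl) | ⟨i, hi, rfl⟩) | ⟨c, -, -, rfl⟩
  · exact h.not_isUnit_x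
  · exact not_isUnit_of_point φ hy
  · exact not_isUnit_of_point φ hz
  · exact h.not_isUnit_v hi
  · refine not_isUnit_of_point φ ?_
    simp [hy, hz, show k ≠ 0 by omega, show l ≠ 0 by omega]

theorem exists_eq_smul_primitive (h : IsModification k l m n x y z v) {g : ℤ} {τ : ℕ} {r : R}
    (hr : r ∈ Submodule.span ℂ {s | IsBihomMonomial k l m n x y z v g τ s})
    (hirr : Irreducible r) : ∃ α : ℂ, α ≠ 0 ∧ ∃ s ∈ primitives k l m x y z v, r = α • s := by
  have hk := h.two_le_k
  have hl := h.two_le_l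
  obtain ⟨M, β, -, hMmem, -, hmon⟩ := h.exists_leading_monomials
  have hrep : ∃ H, IsWeightedHomogeneous ![l, k] H (τ - k * l * β g) ∧
      r = M g * evalYZ y z H := by
    refine Submodule.span_le (p := ((weightedHomogeneousSubmodule ℂ ![l, k]
      (τ - k * l * β g)).map (evalYZ y z).toLinearMap).map (LinearMap.mulLeft ℂ (M g))).2
      (fun s hs => ?_) hr |> fun ⟨_, ⟨H, hH, rfl⟩, hr⟩ => ⟨H, hH, hr.symm⟩
    obtain ⟨j, b, c, rfl, hτ⟩ := hmon g τ s hs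
    refine ⟨_, ⟨cuspPoly k l 1 ^ j * X 0 ^ b * X 1 ^ c, ?_, rfl⟩, ?_⟩
    · have h0 := isWeightedHomogeneous_X ℂ ![l, k] 0
      have h1 := isWeightedHomogeneous_X ℂ ![l, k] 1
      simp only [Matrix.cons_val_zero, Matrix.cons_val_one, Matrix.cons_val_fin_one] at h0 h1
      have hw : IsWeightedHomogeneous ![l, k] (cuspPoly k l 1) (k * l) := by
        have h2 := h0.pow k
        have h3 := h1.pow l
        rw [smul_eq_mul] at h2 h3
        rw [mul_comm l k] at h3
        have := (weightedHomogeneousSubmodule ℂ ![l, k] (k * l)).sub_mem h2 h3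
        simpa [cuspPoly] using this
      have := ((hw.pow j).mul (h0.pow b)).mul (h1.pow c)
      have hτ' : j • (k * l) + b • l + c • k = τ - k * l * β g := by
        refine Nat.eq_sub_of_add_eq ?_
        rw [← hτ]
        simp only [smul_eq_mul]
        ring
      rwa [hτ'] at this
    · simp [evalYZ_cuspPoly]
  obtain ⟨H, hH, rfl⟩ := hrep
  have hH0 : H ≠ 0 := by rintro rfl; exact hirr.ne_zero (by simp)
  obtain ⟨α, s, hs, rfl⟩ := exists_factorization (by omega) (by omega) h.coprime hH hH0
  have hα : α ≠ 0 := by rintro rfl; simp at hH0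
  have hx : x ∈ Submonoid.closure (primitives k l m x y z v) :=
    Submonoid.subset_closure (by simp [primitives])
  have hy : y ∈ Submonoid.closure (primitives k l m x y z v) :=
    Submonoid.subset_closure (by simp [primitives])
  have hz : z ∈ Submonoid.closure (primitives k l m x y z v) :=
    Submonoid.subset_closure (by simp [primitives])
  have hv : ∀ i < m, v i ∈ Submonoid.closure (primitives k l m x y z v) := fun i hi =>
    Submonoid.subset_closure (.inl (.inr ⟨i, hi, rfl⟩))
  have hM : M g ∈ Submonoid.closure (primitives k l m x y z v) := by
    refine Submonoid.closure_le.2 ?_ (hMmem g)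
    rintro _ (rfl | ⟨i, hi, rfl⟩)
    exacts [hx, hv i hi]
  have hS : evalYZ y z s ∈ Submonoid.closure (primitives k l m x y z v) := by
    refine Submonoid.closure_le (S := (Submonoid.closure (primitives k l m x y z v)).comap
      (evalYZ y z)).2 ?_ hs
    rintro _ ((rfl | rfl) | ⟨c, rfl⟩)
    · simpa using hy
    · simpa using hz
    · rw [SetLike.mem_coe, Submonoid.mem_comap, evalYZ_cuspPoly]
      by_cases h0 : c = 0
      · simpa [h0] using Submonoid.pow_mem _ hy k
      by_cases h1 : c = 1
      · rw [h1, one_smul, ← h.rel_zero]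
        exact Submonoid.mul_mem _ hx (hv 0 h.m_pos)
      · exact Submonoid.subset_closure (.inr ⟨c, h0, h1, rfl⟩)
  refine ⟨α, hα, hirr.exists_eq_smul (fun _ => h.not_isUnit_of_mem_primitives)
    (Submonoid.mul_mem _ hM hS) ?_⟩
  have : evalYZ y z (C α) = algebraMap ℂ R α := (evalYZ y z).commutes α
  rw [map_mul, this, Algebra.smul_def]
  ring

end IsModification

end Factorization

/-! ### Derivations of Jacobian type -/

section JacobianType

variable {B : Type*} [CommRing B] [Algebra ℂ B] {x y z : B} {e : ℕ} {a₁ a₂ : B}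
  {δ : Derivation ℂ B B}

theorem IsJacobianType.swap (h : IsJacobianType x y z e a₁ a₂ δ) :
    IsJacobianType x y z e a₂ a₁ (-δ) := by
  obtain ⟨D, hD, h⟩ := h
  refine ⟨D, hD, fun a => ?_⟩
  rw [Derivation.neg_apply, map_neg, h]
  simp only [Matrix.det_fin_three, Matrix.of_apply, Matrix.cons_val_zero, Matrix.cons_val_one,
    Matrix.cons_val]
  ring

theorem IsJacobianType.map_left (h : IsJacobianType x y z e a₁ a₂ δ) : δ a₁ = 0 := by
  obtain ⟨D, -, h⟩ := h
  refine FaithfulSMul.algebraMap_injective B (FractionRing B) ?_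
  rw [h, Matrix.det_zero_of_row_eq (i := 0) (j := 2) (by decide) (by ext j; simp), mul_zero,
    map_zero]

theorem IsJacobianType.map_right (h : IsJacobianType x y z e a₁ a₂ δ) : δ a₂ = 0 := by
  simpa using h.swap.map_left

theorem IsJacobianType.eq_zero_of_proportional {s : B} {α β : ℂ}
    (h : IsJacobianType x y z e (α • s) (β • s) δ) : δ = 0 := by
  obtain ⟨D, -, h⟩ := h
  ext a
  refine FaithfulSMul.algebraMap_injective B (FractionRing B) ?_
  rw [h]
  simp only [Matrix.det_fin_three, Matrix.of_apply, Matrix.cons_val_zero, Matrix.cons_val_one,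
    Matrix.cons_val, algebraMap.coe_smul, Derivation.map_smul, Derivation.zero_apply, map_zero]
  simp only [Algebra.smul_def]
  ring

/-- The value of a derivation of Jacobian type at `x` and, if both entries do not depend on `x`, at
an arbitrary element. -/
theorem IsJacobianType.exists_partial (h : IsJacobianType x y z e a₁ a₂ δ) :
    ∃ D : Fin 3 → Derivation ℂ (FractionRing B) (FractionRing B),
      IsPartialDerivatives (fun j => algebraMap B (FractionRing B) (![x, y, z] j)) D ∧
      algebraMap B (FractionRing B) (δ x) = algebraMap B (FractionRing B) x ^ e *
        (D 1 (algebraMap B _ a₁) * D 2 (algebraMap B _ a₂) -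
          D 2 (algebraMap B _ a₁) * D 1 (algebraMap B _ a₂)) ∧
      (D 0 (algebraMap B _ a₁) = 0 → D 0 (algebraMap B _ a₂) = 0 → ∀ a,
        algebraMap B (FractionRing B) (δ a) =
          algebraMap B (FractionRing B) (δ x) * D 0 (algebraMap B _ a)) := by
  obtain ⟨D, hD, h⟩ := h
  have h0 := hD 0 0
  have h1 := hD 1 0
  have h2 := hD 2 0
  simp only [Matrix.cons_val_zero, if_true] at h0 h1 h2
  rw [if_neg (by decide)] at h1 h2
  have hx : algebraMap B (FractionRing B) (δ x) = algebraMap B (FractionRing B) x ^ e *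
        (D 1 (algebraMap B _ a₁) * D 2 (algebraMap B _ a₂) -
          D 2 (algebraMap B _ a₁) * D 1 (algebraMap B _ a₂)) := by
    rw [h]
    simp only [Matrix.det_fin_three, Matrix.of_apply, Matrix.cons_val_zero, Matrix.cons_val_one,
      Matrix.cons_val, h0, h1, h2]
    ring
  refine ⟨D, hD, hx, fun ha₁ ha₂ a => ?_⟩
  rw [hx, h]
  simp only [Matrix.det_fin_three, Matrix.of_apply, Matrix.cons_val_zero, Matrix.cons_val_one,
    Matrix.cons_val, ha₁, ha₂]
  ring

/-- The partial derivatives of a polynomial in `y` and `z`. -/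
theorem IsPartialDerivatives.map_evalYZ
    {D : Fin 3 → Derivation ℂ (FractionRing B) (FractionRing B)}
    (hD : IsPartialDerivatives (fun j => algebraMap B (FractionRing B) (![x, y, z] j)) D)
    (H : MvPolynomial (Fin 2) ℂ) (j : Fin 3) :
    (j = 0 → D j (algebraMap B _ (evalYZ y z H)) = 0) ∧
      ∃ b, D j (algebraMap B _ (evalYZ y z H)) = algebraMap B _ b := by
  have hX : ∀ i j, (j = 0 → D j (algebraMap B _ (evalYZ y z (MvPolynomial.X i))) = 0) ∧
      ∃ b, D j (algebraMap B _ (evalYZ y z (MvPolynomial.X i))) = algebraMap B _ b := by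
    intro i j
    have h1 := hD j 1
    have h2 := hD j 2
    simp only [Matrix.cons_val_one, Matrix.cons_val] at h1 h2
    fin_cases i
    · simp only [Fin.zero_eta, evalYZ_X_zero, h1]
      exact ⟨by rintro rfl; simp, if j = 1 then 1 else 0, by split_ifs <;> simp⟩
    · simp only [Fin.mk_one, evalYZ_X_one, h2]
      exact ⟨by rintro rfl; simp, if j = 2 then 1 else 0, by split_ifs <;> simp⟩
  induction H using MvPolynomial.induction_on with
  | C c =>
    have : algebraMap B (FractionRing B) (evalYZ y z (MvPolynomial.C c)) =
        algebraMap ℂ (FractionRing B) c := by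
      rw [IsScalarTower.algebraMap_apply ℂ B (FractionRing B)]
      exact congrArg _ ((evalYZ y z).commutes c)
    rw [this, Derivation.map_algebraMap]
    exact ⟨fun _ => rfl, 0, by simp⟩
  | add p q hp hq =>
    obtain ⟨hp0, b, hb⟩ := hp
    obtain ⟨hq0, c, hc⟩ := hq
    simp only [map_add]
    exact ⟨fun hj => by rw [hp0 hj, hq0 hj, add_zero], b + c, by rw [hb, hc, map_add]⟩
  | mul_X p i hp =>
    obtain ⟨hp0, b, hb⟩ := hp
    obtain ⟨hq0, c, hc⟩ := hX i j
    simp only [map_mul, Derivation.leibniz, smul_eq_mul]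
    refine ⟨fun hj => by rw [hp0 hj, hq0 hj]; simp, ?_⟩
    exact ⟨evalYZ y z p * c + evalYZ y z (MvPolynomial.X i) * b, by rw [hb, hc]; simp⟩

/-- A derivation of Jacobian type for a function `s` of `y, z` and for `v = w ^ N / x ^ E`, where
`w` is a function of `y, z`. -/
theorem IsJacobianType.pow_mul_map_x {s w v : B} {α β : ℂ} {E N : ℕ}
    (h : IsJacobianType x y z e (α • s) (β • v) δ) (hv : x ^ E * v = w ^ N) {s₁ s₂ w₁ w₂ : B}
    (hs : ∀ D : Fin 3 → Derivation ℂ (FractionRing B) (FractionRing B),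
      IsPartialDerivatives (fun j => algebraMap B (FractionRing B) (![x, y, z] j)) D →
        D 1 (algebraMap B _ s) = algebraMap B _ s₁ ∧ D 2 (algebraMap B _ s) = algebraMap B _ s₂ ∧
        D 1 (algebraMap B _ w) = algebraMap B _ w₁ ∧ D 2 (algebraMap B _ w) = algebraMap B _ w₂) :
    x ^ E * δ x = (α * β) • (x ^ e * (N * w ^ (N - 1)) * (s₁ * w₂ - s₂ * w₁)) := by
  obtain ⟨D, hD, hx, -⟩ := h.exists_partial
  obtain ⟨hs1, hs2, hw1, hw2⟩ := hs D hD
  have hDx : ∀ j, j ≠ 0 → D j (algebraMap B _ x) = 0 := fun j hj => by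
    have := hD j 0
    rwa [if_neg hj] at this
  have hDv : ∀ j, j ≠ 0 → algebraMap B (FractionRing B) x ^ E * D j (algebraMap B _ v) =
      N * algebraMap B (FractionRing B) w ^ (N - 1) * D j (algebraMap B _ w) := fun j hj => by
    have := congrArg (fun b => D j (algebraMap B (FractionRing B) b)) hv
    simp only [map_mul, map_pow, Derivation.leibniz, Derivation.leibniz_pow, hDx j hj, smul_zero,
      smul_eq_mul, mul_zero, add_zero, nsmul_eq_mul] at this
    rw [this]
    ring
  refine FaithfulSMul.algebraMap_injective B (FractionRing B) ?_
  have h1 := hDv 1 (by decide)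
  have h2 := hDv 2 (by decide)
  rw [hw1] at h1
  rw [hw2] at h2
  rw [map_mul, hx]
  simp only [algebraMap.coe_smul, Derivation.map_smul, hs1, hs2, map_mul, map_pow, map_natCast,
    map_sub]
  simp only [Algebra.smul_def, map_mul]
  linear_combination (algebraMap ℂ (FractionRing B) α * algebraMap ℂ (FractionRing B) β *
    algebraMap B (FractionRing B) x ^ e) * (algebraMap B (FractionRing B) s₁ * h2 -
    algebraMap B (FractionRing B) s₂ * h1)

variable [IsDomain B]

/-- The Jacobian of two polynomials in `y, z` gives no nonzero locally nilpotent derivation: `x`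
would divide its image. -/
theorem IsJacobianType.eq_zero_of_evalYZ {H₁ H₂ : MvPolynomial (Fin 2) ℂ} {α β : ℂ}
    (h : IsJacobianType x y z e (α • evalYZ y z H₁) (β • evalYZ y z H₂) δ) (he : e ≠ 0)
    (hδ : IsLocallyNilpotent δ) : δ = 0 := by
  rw [← map_smul, ← map_smul] at h
  have hinj := FaithfulSMul.algebraMap_injective B (FractionRing B)
  obtain ⟨D, hD, hx, hD0⟩ := h.exists_partial
  obtain ⟨b₁, hb₁⟩ := (hD.map_evalYZ (α • H₁) 1).2
  obtain ⟨b₂, hb₂⟩ := (hD.map_evalYZ (α • H₁) 2).2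
  obtain ⟨c₁, hc₁⟩ := (hD.map_evalYZ (β • H₂) 1).2
  obtain ⟨c₂, hc₂⟩ := (hD.map_evalYZ (β • H₂) 2).2
  have hδx : δ x = x ^ e * (b₁ * c₂ - b₂ * c₁) := by
    apply hinj
    rw [hx, hb₁, hb₂, hc₁, hc₂]
    simp
  have hx0 : δ x = 0 :=
    hδ.eq_zero_of_dvd (hδx ▸ Dvd.dvd.mul_right (dvd_pow_self x he) _)
  ext a
  apply hinj
  rw [hD0 ((hD.map_evalYZ _ 0).1 rfl) ((hD.map_evalYZ _ 0).1 rfl), hx0]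
  simp

end JacobianType

/-! ### Locally nilpotent derivations that annihilate `x` -/

section HomogeneousDerivations

open MvPolynomial

namespace IsModification

variable {k l m : ℕ} {n : ℕ → ℕ} {R : Type*} [CommRing R] [Algebra ℂ R] {x y z : R} {v : ℕ → R}

theorem x_ne_zero (h : IsModification k l m n x y z v) : x ≠ 0 := by
  obtain ⟨φ, hx, -⟩ := h.exists_point 1 0 0 one_ne_zero
  rintro rfl
  simp at hx

theorem y_ne_zero (h : IsModification k l m n x y z v) : y ≠ 0 := by
  obtain ⟨φ, -, hy, -⟩ := h.exists_point 1 1 0 one_ne_zero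
  rintro rfl
  simp at hy

theorem z_ne_zero (h : IsModification k l m n x y z v) : z ≠ 0 := by
  obtain ⟨φ, -, -, hz⟩ := h.exists_point 1 0 1 one_ne_zero
  rintro rfl
  simp at hz

theorem w_ne_zero (h : IsModification k l m n x y z v) : y ^ k - z ^ l ≠ 0 := by
  obtain ⟨φ, -, hy, hz⟩ := h.exists_point 1 1 0 one_ne_zero
  intro hw
  have := congrArg φ hw
  have hl := h.two_le_l
  simp [hy, hz, show l ≠ 0 by omega] at this

theorem wExp_pos (h : IsModification k l m n x y z v) {i : ℕ} (hi : i < m) : 0 < wExp n i :=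
  _root_.wExp_pos fun j hj => h.n_pos j (by omega)

/-- The roles of `y` and `z` can be exchanged. -/
theorem symm (h : IsModification k l m n x y z v) :
    IsModification l k m n x z y fun i => (-1) ^ wExp n i * v i where
  two_le_k := h.two_le_l
  two_le_l := h.two_le_k
  coprime := h.coprime.symm
  m_pos := h.m_pos
  n_pos := h.n_pos
  rel_zero := by
    simp only [wExp]
    linear_combination -h.rel_zero
  rel_succ i hi := by
    simp only [wExp]
    rw [mul_pow, ← h.rel_succ i hi, ← pow_mul, mul_comm (n i)]
    ring
  adjoin_eq_top := by
    rw [eq_top_iff, ← h.adjoin_eq_top]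
    refine Algebra.adjoin_le ?_
    rintro _ ((rfl | rfl | rfl) | ⟨i, hi, rfl⟩)
    · exact Algebra.subset_adjoin (by simp)
    · exact Algebra.subset_adjoin (by simp)
    · exact Algebra.subset_adjoin (by simp)
    · have h1 : v i = (-1) ^ wExp n i * ((-1) ^ wExp n i * v i) := by
        rw [← mul_assoc, ← mul_pow]
        simp
      rw [SetLike.mem_coe, h1]
      refine Subalgebra.mul_mem _ (Subalgebra.pow_mem _ (Subalgebra.neg_mem _
        (Subalgebra.one_mem _)) _) (Algebra.subset_adjoin (.inr ⟨i, hi, rfl⟩))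
  exists_point a b c ha := by
    obtain ⟨φ, hx, hy, hz⟩ := h.exists_point a c b ha
    exact ⟨φ, hx, hz, hy⟩

variable {δ : Derivation ℂ R R}

variable [IsDomain R]

theorem v_ne_zero (h : IsModification k l m n x y z v) {i : ℕ} (hi : i < m) : v i ≠ 0 := by
  intro hv
  have := h.x_pow_mul_v hi
  rw [hv, mul_zero] at this
  exact pow_ne_zero _ h.w_ne_zero this.symm

theorem derivation_eq_zero (h : IsModification k l m n x y z v) (hx : δ x = 0) (hy : δ y = 0)
    (hz : δ z = 0) : δ = 0 := by
  refine Derivation.ext_of_adjoin_eq_top _ h.adjoin_eq_top ?_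
  rintro _ ((rfl | rfl | rfl) | ⟨i, hi, rfl⟩)
  · exact hx
  · exact hy
  · exact hz
  · have := congrArg δ (h.x_pow_mul_v hi)
    simp only [Derivation.leibniz, Derivation.leibniz_pow, map_sub, hx, hy, hz, smul_eq_mul,
      mul_zero, smul_zero, sub_zero, add_zero] at this
    simpa using (mul_eq_zero.1 this).resolve_left (pow_ne_zero _ h.x_ne_zero)

theorem mul_degree_x (h : IsModification k l m n x y z v) (hδ : IsLocallyNilpotent δ) {i : ℕ}
    (hi : i < m) :
    xExp n i * derivationDegree δ x + derivationDegree δ (v i) =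
      wExp n i * derivationDegree δ (y ^ k - z ^ l) := by
  rw [← hδ.degree_pow h.w_ne_zero, ← h.x_pow_mul_v hi,
    hδ.degree_mul (pow_ne_zero _ h.x_ne_zero) (h.v_ne_zero hi), hδ.degree_pow h.x_ne_zero]

/-- If `δ x = 0` and `a * y ^ i * δ y = b * z ^ j * δ z` with constants `a ≠ 0` and `b`, then
`z ^ j` divides `δ y` up to a power of `x`. -/
theorem mul_degree_lt (h : IsModification k l m n x y z v) (hδ : IsLocallyNilpotent δ)
    (hx : δ x = 0) {i j : ℕ} {a b : ℂ} (ha : a ≠ 0)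
    (hy : δ y ≠ 0) (hab : a • (y ^ i * δ y) = b • (z ^ j * δ z)) :
    j * derivationDegree δ z < derivationDegree δ y := by
  obtain ⟨T, P, hP, -⟩ := h.exists_pow_mul_eq (δ y)
  obtain ⟨T', Q, hQ, -⟩ := h.exists_pow_mul_eq (δ z)
  have hdvd : (Polynomial.C (X 1) : Polynomial (MvPolynomial (Fin 2) ℂ)) ^ j ∣ P := by
    refine Prime.pow_dvd_of_dvd_mul_left (Polynomial.prime_C_iff.2 X_prime) j
      (a := Polynomial.C (C a * X 0 ^ i) * Polynomial.X ^ T') ?_ ?_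
    · rintro ⟨q, hq⟩
      have := congrArg (Polynomial.eval₂ (eval ![1, 0]) 1) hq
      simp [Polynomial.eval₂_mul, ha] at this
    · refine ⟨Polynomial.C (C b) * Polynomial.X ^ T * Q, h.evalXYZ_injective ?_⟩
      have hC : ∀ c : ℂ, evalYZ y z (C c) = algebraMap ℂ R c := fun c => (evalYZ y z).commutes c
      simp only [map_mul, map_pow, evalXYZ_C, evalXYZ_X, evalYZ_X_zero, evalYZ_X_one, ← hP, ← hQ,
        hC]
      simp only [Algebra.smul_def] at hab
      linear_combination x ^ T * x ^ T' * hab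
  obtain ⟨q, rfl⟩ := hdvd
  simp only [map_mul, map_pow, evalXYZ_C, evalYZ_X_one] at hP
  have hxy : x ^ T * δ y ≠ 0 := mul_ne_zero (pow_ne_zero _ h.x_ne_zero) hy
  have hq : evalXYZ x y z q ≠ 0 := by
    intro h0
    rw [h0, mul_zero] at hP
    exact hxy hP
  have hdeg := congrArg (derivationDegree δ) hP
  rw [hδ.degree_mul (pow_ne_zero _ h.x_ne_zero) hy, hδ.degree_pow h.x_ne_zero,
    hδ.degree_mul (pow_ne_zero _ h.z_ne_zero) hq, hδ.degree_pow h.z_ne_zero,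
    derivationDegree_eq_zero_of_ker hx] at hdeg
  have := hδ.degree_map_add_one hy
  omega

/-- No nonzero locally nilpotent derivation annihilates `x` and a binomial in `y ^ k, z ^ l`:
each of `y` and `z` would have larger degree than the other one. -/
theorem eq_zero_of_binomial (h : IsModification k l m n x y z v) (hδ : IsLocallyNilpotent δ)
    (hx : δ x = 0) {c : ℂ} (hc : c ≠ 0) (hyz : δ (y ^ k - c • z ^ l) = 0) : δ = 0 := by
  by_contra hne
  have hk := h.two_le_k
  have hl := h.two_le_l
  rw [map_sub, Derivation.map_smul, Derivation.leibniz_pow, Derivation.leibniz_pow, sub_eq_zero]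
    at hyz
  have hrel : (k : ℂ) • (y ^ (k - 1) * δ y) = (c * l) • (z ^ (l - 1) * δ z) := by
    rw [mul_smul, Nat.cast_smul_eq_nsmul, Nat.cast_smul_eq_nsmul]
    exact hyz
  have hk0 : (k : ℂ) ≠ 0 := by exact_mod_cast show k ≠ 0 by omega
  have hl0 : c * l ≠ 0 := mul_ne_zero hc (by exact_mod_cast show l ≠ 0 by omega)
  have hy : δ y ≠ 0 := by
    intro hy
    refine hne (h.derivation_eq_zero hx hy ?_)
    rw [hy, mul_zero, smul_zero] at hrel
    exact (mul_eq_zero.1 ((smul_eq_zero.1 hrel.symm).resolve_left hl0)).resolve_left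
      (pow_ne_zero _ h.z_ne_zero)
  have hz : δ z ≠ 0 := by
    intro hz
    rw [hz, mul_zero, smul_zero] at hrel
    exact hy ((mul_eq_zero.1 ((smul_eq_zero.1 hrel).resolve_left hk0)).resolve_left
      (pow_ne_zero _ h.y_ne_zero))
  have h1 := h.mul_degree_lt hδ hx hk0 hy hrel
  have h2 : (k - 1) * derivationDegree δ y < derivationDegree δ z := by
    exact h.symm.mul_degree_lt hδ hx hl0 hz hrel.symm
  have h3 := Nat.le_mul_of_pos_left (derivationDegree δ z) (show 0 < l - 1 by omega)
  have h4 := Nat.le_mul_of_pos_left (derivationDegree δ y) (show 0 < k - 1 by omega)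
  omega

end IsModification

end HomogeneousDerivations

/-! ### Locally nilpotent derivations of Jacobian type -/

section ClassificationOfDerivations

open MvPolynomial

namespace IsModification

variable {k l m : ℕ} {n : ℕ → ℕ} {R : Type*} [CommRing R] [Algebra ℂ R] {x y z : R} {v : ℕ → R}
  [IsDomain R] {δ : Derivation ℂ R R}

/-- The degrees of `x` and `w` for a derivation that annihilates `v_i = w ^ N / x ^ E` and for which
`x ^ E * δ x` is a multiple of `x ^ m * w ^ (N - 1) * b`. -/
theorem degree_eqs_of_v (h : IsModification k l m n x y z v) (hδ : IsLocallyNilpotent δ) {i : ℕ}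
    (hi : i < m) (hv : δ (v i) = 0) {κ : ℂ} {b : R} (hκ : κ ≠ 0) (hb : b ≠ 0)
    (hx : x ^ xExp n i * δ x = κ • (x ^ m * (y ^ k - z ^ l) ^ (wExp n i - 1) * b)) :
    0 < derivationDegree δ x ∧ 0 < derivationDegree δ (y ^ k - z ^ l) ∧
      derivationDegree δ (y ^ k - z ^ l) ≤ m * derivationDegree δ x ∧
      derivationDegree δ (y ^ k - z ^ l) + derivationDegree δ x =
        m * derivationDegree δ x + derivationDegree δ b + 1 := by
  have hx0 := h.x_ne_zero
  have hw0 := h.w_ne_zero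
  have hN := h.wExp_pos hi
  have hE := xExp_pos n i
  have hEN : xExp n i ≤ (i + 1) * wExp n i := xExp_le fun j hj => h.n_pos j (by omega)
  have hrhs : x ^ m * (y ^ k - z ^ l) ^ (wExp n i - 1) * b ≠ 0 :=
    mul_ne_zero (mul_ne_zero (pow_ne_zero _ hx0) (pow_ne_zero _ hw0)) hb
  have hδx : δ x ≠ 0 := by
    intro h0
    rw [h0, mul_zero] at hx
    exact (smul_ne_zero hκ hrhs) hx.symm
  have h1 := hδ.degree_map_add_one hδx
  have h2 := h.mul_degree_x hδ hi
  rw [derivationDegree_eq_zero_of_ker hv, add_zero] at h2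
  have h3 := congrArg (derivationDegree δ) hx
  rw [hδ.degree_smul hκ hrhs, hδ.degree_mul (pow_ne_zero _ hx0) hδx,
    hδ.degree_mul (mul_ne_zero (pow_ne_zero _ hx0) (pow_ne_zero _ hw0)) hb,
    hδ.degree_mul (pow_ne_zero _ hx0) (pow_ne_zero _ hw0), hδ.degree_pow hx0, hδ.degree_pow hw0,
    hδ.degree_pow hx0] at h3
  generalize derivationDegree δ (y ^ k - z ^ l) = W at *
  generalize derivationDegree δ (δ x) = X' at *
  generalize derivationDegree δ b = b' at *
  rw [← h1] at h2 h3 ⊢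
  generalize wExp n i = N at *
  generalize xExp n i = E at *
  obtain ⟨N, rfl⟩ := Nat.exists_eq_succ_of_ne_zero hN.ne'
  rw [Nat.succ_eq_add_one, Nat.add_sub_cancel] at *
  have hW : 0 < W := by
    rcases Nat.eq_zero_or_pos W with rfl | hW
    · nlinarith
    · exact hW
  refine ⟨by omega, hW, ?_, by nlinarith⟩
  refine Nat.le_of_mul_le_mul_left (?_ : (N + 1) * W ≤ (N + 1) * (m * (X' + 1))) hN
  calc (N + 1) * W = E * (X' + 1) := h2.symm
    _ ≤ (m * (N + 1)) * (X' + 1) :=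
      Nat.mul_le_mul_right _ (hEN.trans (Nat.mul_le_mul_right _ hi))
    _ = _ := by ring

theorem mul_degree_z_of_map_y (h : IsModification k l m n x y z v) (hδ : IsLocallyNilpotent δ)
    (hy : δ y = 0) (hw : derivationDegree δ (y ^ k - z ^ l) ≠ 0) :
    l * derivationDegree δ z = derivationDegree δ (y ^ k - z ^ l) := by
  rw [← derivationDegree_add_of_ker (b := -y ^ k) (by simp [Derivation.leibniz_pow, hy]) hw]
  have : y ^ k - z ^ l + -y ^ k = (-1 : ℂ) • z ^ l := by rw [neg_one_smul]; ring
  rw [this, hδ.degree_smul (by norm_num) (pow_ne_zero _ h.z_ne_zero), hδ.degree_pow h.z_ne_zero]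

theorem mul_degree_of_map_binomial (h : IsModification k l m n x y z v)
    (hδ : IsLocallyNilpotent δ) {c : ℂ} (hc0 : c ≠ 0) (hc : c ≠ 1)
    (hyz : δ (y ^ k - c • z ^ l) = 0)
    (hw : derivationDegree δ (y ^ k - z ^ l) ≠ 0) :
    k * derivationDegree δ y = derivationDegree δ (y ^ k - z ^ l) ∧
      l * derivationDegree δ z = derivationDegree δ (y ^ k - z ^ l) := by
  have hc' : c - 1 ≠ 0 := sub_ne_zero.2 hc
  constructor
  · have hw' := hδ.degree_smul hc0 h.w_ne_zero
    rw [← hw'] at hw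
    rw [← hw', ← derivationDegree_add_of_ker (b := -(y ^ k - c • z ^ l))
      (by rw [map_neg, hyz, neg_zero]) hw]
    have : c • (y ^ k - z ^ l) + -(y ^ k - c • z ^ l) = (c - 1) • y ^ k := by
      rw [sub_smul, smul_sub, one_smul]; ring
    rw [this, hδ.degree_smul hc' (pow_ne_zero _ h.y_ne_zero), hδ.degree_pow h.y_ne_zero]
  · rw [← derivationDegree_add_of_ker (b := -(y ^ k - c • z ^ l))
      (by rw [map_neg, hyz, neg_zero]) hw]
    have : y ^ k - z ^ l + -(y ^ k - c • z ^ l) = (c - 1) • z ^ l := by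
      rw [sub_smul, one_smul]; ring
    rw [this, hδ.degree_smul hc' (pow_ne_zero _ h.z_ne_zero), hδ.degree_pow h.z_ne_zero]

/-- The partial derivatives of `y`, `z` and of binomials in `y, z`. -/
theorem _root_.IsPartialDerivatives.map_binomial {B : Type*} [CommRing B] [Algebra ℂ B] {x y z : B}
    {D : Fin 3 → Derivation ℂ (FractionRing B) (FractionRing B)}
    (hD : IsPartialDerivatives (fun j => algebraMap B (FractionRing B) (![x, y, z] j)) D)
    (k l : ℕ) (c : ℂ) :
    D 1 (algebraMap B _ (y ^ k - c • z ^ l)) = algebraMap B _ (k * y ^ (k - 1)) ∧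
      D 2 (algebraMap B _ (y ^ k - c • z ^ l)) = algebraMap B _ (-c • (l * z ^ (l - 1))) := by
  have h11 := hD 1 1
  have h12 := hD 1 2
  have h21 := hD 2 1
  have h22 := hD 2 2
  simp only [Matrix.cons_val_one, Matrix.cons_val, if_true] at h11 h12 h21 h22
  rw [if_neg (by decide)] at h12 h21
  simp only [map_sub, map_pow, algebraMap.coe_smul, Derivation.map_smul, Derivation.leibniz_pow,
    h11, h12, h21, h22]
  simp [Algebra.smul_def]

/-- The Jacobian of one of the `v_i` and an irreducible homogeneous polynomial in `y, z` gives no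
nonzero locally nilpotent derivation. -/
theorem not_isJacobianType_v (h : IsModification k l m n x y z v) (hm : 2 ≤ m)
    (hδ : IsLocallyNilpotent δ) {δ' : Derivation ℂ R R} (hδ' : δ' = δ ∨ δ' = -δ) {i : ℕ}
    (hi : i < m) {s : R} (hs : s = y ∨ s = z ∨ ∃ c : ℂ, c ≠ 0 ∧ c ≠ 1 ∧ s = y ^ k - c • z ^ l) {α β : ℂ}
    (hα : α ≠ 0) (hβ : β ≠ 0) (hJ : IsJacobianType x y z m (α • s) (β • v i) δ') : False := by
  have hk := h.two_le_k
  have hl := h.two_le_l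
  have hker : ∀ a, δ' a = 0 → δ a = 0 := by
    rcases hδ' with rfl | rfl
    · exact fun a ha => ha
    · intro a ha; simpa using ha
  have hs0 : δ s = 0 := hker s (by simpa [hα] using hJ.map_left)
  have hv0 : δ (v i) = 0 := hker _ (by simpa [hβ] using hJ.map_right)
  have hN0 : (wExp n i : ℂ) ≠ 0 := by exact_mod_cast (h.wExp_pos hi).ne'
  have hk0 : (k : ℂ) ≠ 0 := by exact_mod_cast show k ≠ 0 by omega
  have hl0 : (l : ℂ) ≠ 0 := by exact_mod_cast show l ≠ 0 by omega
  -- The sign of the derivation plays no role.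
  have hsign : ∀ {κ : ℂ} {b : R}, κ ≠ 0 →
      x ^ xExp n i * δ' x = κ • (x ^ m * (y ^ k - z ^ l) ^ (wExp n i - 1) * b) →
      ∃ κ' : ℂ, κ' ≠ 0 ∧
        x ^ xExp n i * δ x = κ' • (x ^ m * (y ^ k - z ^ l) ^ (wExp n i - 1) * b) := by
    intro κ b hκ hx
    rcases hδ' with rfl | rfl
    · exact ⟨κ, hκ, hx⟩
    · refine ⟨-κ, neg_ne_zero.2 hκ, ?_⟩
      rw [neg_smul, ← hx, Derivation.neg_apply]
      ring
  have hpart : ∀ D : Fin 3 → Derivation ℂ (FractionRing R) (FractionRing R),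
      IsPartialDerivatives (fun j => algebraMap R (FractionRing R) (![x, y, z] j)) D →
      D 1 (algebraMap R _ (y ^ k - z ^ l)) = algebraMap R _ (k * y ^ (k - 1)) ∧
      D 2 (algebraMap R _ (y ^ k - z ^ l)) = algebraMap R _ (-(l * z ^ (l - 1))) := by
    intro D hD
    simpa using hD.map_binomial k l 1
  have hpart' : ∀ D : Fin 3 → Derivation ℂ (FractionRing R) (FractionRing R),
      IsPartialDerivatives (fun j => algebraMap R (FractionRing R) (![x, y, z] j)) D →
      ∀ i j, D i (algebraMap R (FractionRing R) (![x, y, z] j)) =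
        algebraMap R _ (if i = j then 1 else 0) := by
    intro D hD i j
    rw [hD i j]
    split_ifs <;> simp
  have hyp := pow_ne_zero (k - 1) h.y_ne_zero
  have hzp := pow_ne_zero (l - 1) h.z_ne_zero
  rcases hs with rfl | rfl | ⟨c, hc0, hc1, rfl⟩
  · have hx := hJ.pow_mul_map_x (h.x_pow_mul_v hi) (s₁ := 1) (s₂ := 0)
      fun D hD => ⟨hpart' D hD 1 1, hpart' D hD 2 1, hpart D hD⟩
    obtain ⟨κ, hκ, hx⟩ := hsign (κ := -(α * β * wExp n i * l)) (b := z ^ (l - 1))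
      (neg_ne_zero.2 (mul_ne_zero (mul_ne_zero (mul_ne_zero hα hβ) hN0) hl0)) (by
        rw [hx]
        simp only [Algebra.smul_def, map_mul, map_neg, map_natCast]
        ring)
    obtain ⟨hX, hW, h1, h2⟩ := h.degree_eqs_of_v hδ hi hv0 hκ hzp hx
    have h3 := h.mul_degree_z_of_map_y hδ hs0 hW.ne'
    rw [hδ.degree_pow h.z_ne_zero, ← h3] at h2
    rw [← h3] at h1
    obtain ⟨l, rfl⟩ := Nat.exists_eq_add_of_le' hl
    obtain ⟨m, rfl⟩ := Nat.exists_eq_add_of_le' hm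
    rw [show l + 2 - 1 = l + 1 by omega] at h2
    nlinarith [Nat.zero_le (l * derivationDegree δ z), Nat.zero_le (m * derivationDegree δ x)]
  · have hx := hJ.pow_mul_map_x (h.x_pow_mul_v hi) (s₁ := 0) (s₂ := 1)
      fun D hD => ⟨hpart' D hD 1 2, hpart' D hD 2 2, hpart D hD⟩
    obtain ⟨κ, hκ, hx⟩ := hsign (κ := -(α * β * wExp n i * k)) (b := y ^ (k - 1))
      (neg_ne_zero.2 (mul_ne_zero (mul_ne_zero (mul_ne_zero hα hβ) hN0) hk0)) (by
        rw [hx]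
        simp only [Algebra.smul_def, map_mul, map_neg, map_natCast]
        ring)
    obtain ⟨hX, hW, h1, h2⟩ := h.degree_eqs_of_v hδ hi hv0 hκ hyp hx
    have hneg : derivationDegree δ (s ^ l - y ^ k) = derivationDegree δ (y ^ k - s ^ l) := by
      rw [← hδ.degree_smul (c := -1) (by norm_num) h.w_ne_zero, neg_one_smul, neg_sub]
    have h3 := h.symm.mul_degree_z_of_map_y hδ hs0 (by rw [hneg]; exact hW.ne')
    rw [hneg] at h3
    rw [hδ.degree_pow h.y_ne_zero, ← h3] at h2
    rw [← h3] at h1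
    obtain ⟨k, rfl⟩ := Nat.exists_eq_add_of_le' hk
    obtain ⟨m, rfl⟩ := Nat.exists_eq_add_of_le' hm
    rw [show k + 2 - 1 = k + 1 by omega] at h2
    nlinarith [Nat.zero_le (k * derivationDegree δ y), Nat.zero_le (m * derivationDegree δ x)]
  · have hx := hJ.pow_mul_map_x (h.x_pow_mul_v hi)
      fun D hD => ⟨(hD.map_binomial k l c).1, (hD.map_binomial k l c).2, hpart D hD⟩
    obtain ⟨κ, hκ, hx⟩ := hsign (κ := α * β * wExp n i * (k * l * (c - 1)))
      (b := y ^ (k - 1) * z ^ (l - 1))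
      (mul_ne_zero (mul_ne_zero (mul_ne_zero hα hβ) hN0)
        (mul_ne_zero (mul_ne_zero hk0 hl0) (sub_ne_zero.2 hc1))) (by
        rw [hx]
        simp only [Algebra.smul_def, map_mul, map_neg, map_sub, map_one, map_natCast]
        ring)
    obtain ⟨hX, hW, h1, h2⟩ := h.degree_eqs_of_v hδ hi hv0 hκ (mul_ne_zero hyp hzp) hx
    obtain ⟨h3, h4⟩ := h.mul_degree_of_map_binomial hδ hc0 hc1 hs0 hW.ne'
    rw [hδ.degree_mul hyp hzp, hδ.degree_pow h.y_ne_zero, hδ.degree_pow h.z_ne_zero] at h2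
    obtain ⟨l, rfl⟩ := Nat.exists_eq_add_of_le' hl
    obtain ⟨k, rfl⟩ := Nat.exists_eq_add_of_le' hk
    obtain ⟨m, rfl⟩ := Nat.exists_eq_add_of_le' hm
    rw [show l + 2 - 1 = l + 1 by omega, show k + 2 - 1 = k + 1 by omega] at h2
    nlinarith [Nat.zero_le (k * derivationDegree δ y), Nat.zero_le (l * derivationDegree δ z),
      Nat.zero_le (m * derivationDegree δ x)]

theorem eq_zero_of_map_w (h : IsModification k l m n x y z v) (hδ : IsLocallyNilpotent δ)
    (hx : δ x = 0) (hw : derivationDegree δ (y ^ k - z ^ l) = 0) : δ = 0 := by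
  refine h.eq_zero_of_binomial hδ hx one_ne_zero ?_
  rw [one_smul]
  exact hδ.ker_of_degree_eq_zero hw

/-- A nonzero locally nilpotent derivation annihilates at most one of the `v_i`. -/
theorem eq_zero_of_map_v_v (h : IsModification k l m n x y z v) (hδ : IsLocallyNilpotent δ)
    {i j : ℕ} (hi : i < m) (hj : j < m) (hij : i ≠ j) (hvi : δ (v i) = 0) (hvj : δ (v j) = 0) :
    δ = 0 := by
  wlog hlt : i < j generalizing i j
  · exact this hj hi hij.symm hvj hvi (by omega)
  have h1 := h.mul_degree_x hδ hi
  have h2 := h.mul_degree_x hδ hj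
  rw [derivationDegree_eq_zero_of_ker hvi, add_zero] at h1
  rw [derivationDegree_eq_zero_of_ker hvj, add_zero] at h2
  have h3 := xExp_mul_wExp_lt hlt fun s hs => h.n_pos s (by omega)
  have h4 : derivationDegree δ x = 0 := by
    by_contra h0
    have h5 := Nat.mul_lt_mul_of_pos_right h3 (Nat.pos_of_ne_zero h0)
    have h6 : xExp n i * wExp n j * derivationDegree δ x =
        xExp n j * wExp n i * derivationDegree δ x := by
      calc _ = wExp n j * (xExp n i * derivationDegree δ x) := by ring
        _ = wExp n i * (wExp n j * derivationDegree δ (y ^ k - z ^ l)) := by rw [h1]; ring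
        _ = _ := by rw [← h2]; ring
    omega
  rw [h4, mul_zero] at h1
  refine h.eq_zero_of_map_w hδ (hδ.ker_of_degree_eq_zero h4) ?_
  exact (Nat.mul_eq_zero.1 h1.symm).resolve_left (h.wExp_pos hi).ne'

theorem eq_y_or_eq_z_of_map_x (h : IsModification k l m n x y z v) (hδ : IsLocallyNilpotent δ)
    (hδ0 : δ ≠ 0) (hx : δ x = 0) {s : R} (hs : s ∈ primitives k l m x y z v) (hs0 : δ s = 0) :
    s = x ∨ s = y ∨ s = z := by
  rcases hs with (hs | ⟨i, hi, rfl⟩) | ⟨c, hc0, -, rfl⟩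
  · exact hs
  · refine absurd (h.eq_zero_of_map_w hδ hx ?_) hδ0
    have h1 := h.mul_degree_x hδ hi
    rw [derivationDegree_eq_zero_of_ker hs0, derivationDegree_eq_zero_of_ker hx, mul_zero,
      add_zero] at h1
    exact (Nat.mul_eq_zero.1 h1.symm).resolve_left (h.wExp_pos hi).ne'
  · exact absurd (h.eq_zero_of_binomial hδ hx hc0 hs0) hδ0

theorem two_le_degree_v (h : IsModification k l m n x y z v) (hδ : IsLocallyNilpotent δ)
    (hδ0 : δ ≠ 0) (hx : δ x = 0) (hyz : δ y = 0 ∨ δ z = 0) {i : ℕ} (hi : i < m) :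
    2 ≤ derivationDegree δ (v i) := by
  have hw : derivationDegree δ (y ^ k - z ^ l) ≠ 0 := fun hw => hδ0 (h.eq_zero_of_map_w hδ hx hw)
  have h1 := h.mul_degree_x hδ hi
  rw [derivationDegree_eq_zero_of_ker hx, mul_zero, zero_add] at h1
  have h2 : 2 ≤ derivationDegree δ (y ^ k - z ^ l) := by
    rcases hyz with hy | hz
    · have h3 := h.mul_degree_z_of_map_y hδ hy hw
      have := h.two_le_l
      rw [← h3] at hw ⊢
      have := Nat.pos_of_ne_zero (right_ne_zero_of_mul hw)
      nlinarith
    · have hneg : derivationDegree δ (z ^ l - y ^ k) = derivationDegree δ (y ^ k - z ^ l) := by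
        rw [← hδ.degree_smul (c := -1) (by norm_num) h.w_ne_zero, neg_one_smul, neg_sub]
      have h3 := h.symm.mul_degree_z_of_map_y hδ hz (by rw [hneg]; exact hw)
      rw [hneg] at h3
      have := h.two_le_k
      rw [← h3] at hw ⊢
      have := Nat.pos_of_ne_zero (right_ne_zero_of_mul hw)
      nlinarith
  rw [h1]
  have := h.wExp_pos hi
  nlinarith

/-- The homogeneous locally nilpotent derivations of Jacobian type. -/
theorem classification (h : IsModification k l m n x y z v) (hm : 2 ≤ m)
    (hδ : IsLocallyNilpotent δ) (hδ0 : δ ≠ 0) {s₁ s₂ : R} {α β : ℂ} (hα : α ≠ 0) (hβ : β ≠ 0)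
    (hs₁ : s₁ ∈ primitives k l m x y z v) (hs₂ : s₂ ∈ primitives k l m x y z v)
    (hJ : IsJacobianType x y z m (α • s₁) (β • s₂) δ) :
    (s₁ = x ∧ s₂ = y) ∨ (s₁ = x ∧ s₂ = z) ∨ (s₁ = y ∧ s₂ = x) ∨ (s₁ = z ∧ s₂ = x) := by
  have h1 : δ s₁ = 0 := by simpa [hα] using hJ.map_left
  have h2 : δ s₂ = 0 := by simpa [hβ] using hJ.map_right
  have hne : s₁ ≠ s₂ := by
    rintro rfl
    exact hδ0 hJ.eq_zero_of_proportional
  rcases primitives_cases hs₁ with rfl | hs₁'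
  · rcases h.eq_y_or_eq_z_of_map_x hδ hδ0 h1 hs₂ h2 with h' | h' | h'
    · exact absurd h'.symm hne
    · exact .inl ⟨rfl, h'⟩
    · exact .inr (.inl ⟨rfl, h'⟩)
  rcases primitives_cases hs₂ with rfl | hs₂'
  · rcases h.eq_y_or_eq_z_of_map_x hδ hδ0 h2 hs₁ h1 with h' | h' | h'
    · exact absurd h' hne
    · exact .inr (.inr (.inl ⟨h', rfl⟩))
    · exact .inr (.inr (.inr ⟨h', rfl⟩))
  exfalso
  rcases hs₁' with ⟨i, hi, rfl⟩ | ⟨⟨H₁, hH₁⟩, hs₁'⟩ <;>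
    rcases hs₂' with ⟨j, hj, rfl⟩ | ⟨⟨H₂, hH₂⟩, hs₂'⟩
  · exact hδ0 (h.eq_zero_of_map_v_v hδ hi hj (fun hij => hne (by rw [hij])) h1 h2)
  · exact h.not_isJacobianType_v hm hδ (.inr rfl) hi hs₂' hβ hα hJ.swap
  · exact h.not_isJacobianType_v hm hδ (.inl rfl) hj hs₁' hα hβ hJ
  · rw [hH₁, hH₂] at hJ
    exact hδ0 (hJ.eq_zero_of_evalYZ (by omega) hδ)

end IsModification

end ClassificationOfDerivations

/-! ### Symbols in the associated graded algebra -/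

section Symbols

namespace RealFiltration

variable {A : Type*} [CommRing A] [Algebra ℂ A] {𝓕 : RealFiltration A}

/-- `g` is the class of `a ∈ F t` in degree `t`. -/
def IsSymbol (𝓕 : RealFiltration A) (t : ℝ) (a : A) (g : 𝓕.Gr) : Prop :=
  ∃ h : a ∈ 𝓕.F t, g = 𝓕.symbol t ⟨a, h⟩

theorem symbol_mul {s t : ℝ} {a b : A} (ha : a ∈ 𝓕.F s) (hb : b ∈ 𝓕.F t) :
    𝓕.symbol s ⟨a, ha⟩ * 𝓕.symbol t ⟨b, hb⟩ = 𝓕.symbol (s + t) ⟨a * b, 𝓕.mul_mem ha hb⟩ := by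
  refine (map_mul (Ideal.Quotient.mk 𝓕.reesLt) _ _).symm.trans (congrArg _ (Subtype.ext ?_))
  exact AddMonoidAlgebra.single_mul_single ..

theorem symbol_add {t : ℝ} (a b : 𝓕.F t) :
    𝓕.symbol t (a + b) = 𝓕.symbol t a + 𝓕.symbol t b := by
  refine Eq.trans (congrArg (Ideal.Quotient.mk 𝓕.reesLt) (Subtype.ext ?_))
    (map_add (Ideal.Quotient.mk 𝓕.reesLt) _ _)
  exact AddMonoidAlgebra.single_add ..

theorem symbol_smul {t : ℝ} (c : ℂ) (a : 𝓕.F t) : 𝓕.symbol t (c • a) = c • 𝓕.symbol t a := by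
  refine Eq.trans (congrArg (Ideal.Quotient.mk 𝓕.reesLt) (Subtype.ext ?_))
    (map_smul (Ideal.Quotient.mkₐ ℂ 𝓕.reesLt) c _)
  exact (AddMonoidAlgebra.smul_single ..).symm

theorem symbol_eq_zero {t : ℝ} (a : 𝓕.F t) (ha : a.1 ∈ 𝓕.lt t) : 𝓕.symbol t a = 0 := by
  classical
  refine Ideal.Quotient.eq_zero_iff_mem.2 fun s => ?_
  change (AddMonoidAlgebra.single t a.1).coeff s ∈ 𝓕.lt s
  rw [AddMonoidAlgebra.coeff_single, Finsupp.single_apply]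
  split_ifs with h
  · rwa [← h]
  · exact Submodule.zero_mem _

namespace IsSymbol

theorem mul {s t : ℝ} {a b : A} {g g' : 𝓕.Gr} (h : 𝓕.IsSymbol s a g) (h' : 𝓕.IsSymbol t b g') :
    𝓕.IsSymbol (s + t) (a * b) (g * g') := by
  obtain ⟨ha, rfl⟩ := h
  obtain ⟨hb, rfl⟩ := h'
  exact ⟨_, symbol_mul ha hb⟩

theorem one : 𝓕.IsSymbol 0 1 1 :=
  ⟨𝓕.one_mem, (map_one (Ideal.Quotient.mk 𝓕.reesLt)).symm⟩

theorem pow {t : ℝ} {a : A} {g : 𝓕.Gr} (h : 𝓕.IsSymbol t a g) (n : ℕ) :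
    𝓕.IsSymbol (n * t) (a ^ n) (g ^ n) := by
  induction n with
  | zero => simpa using one
  | succ n ih =>
    rw [pow_succ, pow_succ, Nat.cast_succ, add_mul, one_mul]
    exact ih.mul h

theorem prod {ι : Type*} (s : Finset ι) {t : ι → ℝ} {a : ι → A} {g : ι → 𝓕.Gr}
    (h : ∀ i ∈ s, 𝓕.IsSymbol (t i) (a i) (g i)) :
    𝓕.IsSymbol (∑ i ∈ s, t i) (∏ i ∈ s, a i) (∏ i ∈ s, g i) := by
  classical
  induction s using Finset.induction_on with
  | empty => simpa using one
  | insert i s hi ih =>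
    rw [Finset.sum_insert hi, Finset.prod_insert hi, Finset.prod_insert hi]
    exact (h i (by simp)).mul (ih fun j hj => h j (by simp [hj]))

theorem add {t : ℝ} {a b : A} {g g' : 𝓕.Gr} (h : 𝓕.IsSymbol t a g) (h' : 𝓕.IsSymbol t b g') :
    𝓕.IsSymbol t (a + b) (g + g') := by
  obtain ⟨ha, rfl⟩ := h
  obtain ⟨hb, rfl⟩ := h'
  exact ⟨Submodule.add_mem _ ha hb, (symbol_add ⟨a, ha⟩ ⟨b, hb⟩).symm⟩

theorem smul {t : ℝ} {a : A} {g : 𝓕.Gr} (c : ℂ) (h : 𝓕.IsSymbol t a g) :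
    𝓕.IsSymbol t (c • a) (c • g) := by
  obtain ⟨ha, rfl⟩ := h
  exact ⟨Submodule.smul_mem _ c ha, (symbol_smul c ⟨a, ha⟩).symm⟩

theorem sub {t : ℝ} {a b : A} {g g' : 𝓕.Gr} (h : 𝓕.IsSymbol t a g) (h' : 𝓕.IsSymbol t b g') :
    𝓕.IsSymbol t (a - b) (g - g') := by
  rw [sub_eq_add_neg, sub_eq_add_neg, ← neg_one_smul ℂ b, ← neg_one_smul ℂ g']
  exact h.add (h'.smul _)

theorem sum {ι : Type*} (s : Finset ι) {t : ℝ} {a : ι → A} {g : ι → 𝓕.Gr}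
    (h : ∀ i ∈ s, 𝓕.IsSymbol t (a i) (g i)) :
    𝓕.IsSymbol t (∑ i ∈ s, a i) (∑ i ∈ s, g i) := by
  classical
  induction s using Finset.induction_on with
  | empty =>
    refine ⟨by simp, ?_⟩
    rw [symbol_eq_zero _ (by simp), Finset.sum_empty]
  | insert i s hi ih =>
    rw [Finset.sum_insert hi, Finset.sum_insert hi]
    exact (h i (by simp)).add (ih fun j hj => h j (by simp [hj]))

theorem eq_zero {t : ℝ} {a : A} {g : 𝓕.Gr} (h : 𝓕.IsSymbol t a g) (ha : a ∈ 𝓕.lt t) : g = 0 := by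
  obtain ⟨h, rfl⟩ := h
  exact symbol_eq_zero _ ha

theorem eq_of_sub_mem {t : ℝ} {a b : A} {g g' : 𝓕.Gr} (h : 𝓕.IsSymbol t a g)
    (h' : 𝓕.IsSymbol t b g') (hab : a - b ∈ 𝓕.lt t) : g = g' :=
  sub_eq_zero.1 ((h.sub h').eq_zero hab)

end IsSymbol

theorem mem_span_isHomogeneousElt (g : 𝓕.Gr) :
    g ∈ Submodule.span ℂ {g | 𝓕.IsHomogeneousElt g} := by
  classical
  obtain ⟨f, rfl⟩ := Ideal.Quotient.mk_surjective (I := 𝓕.reesLt) g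
  have hf : f = ∑ t ∈ f.1.coeff.support, (⟨AddMonoidAlgebra.single t (f.1.coeff t), by
      intro s
      rw [AddMonoidAlgebra.coeff_single, Finsupp.single_apply]
      split_ifs with h
      · rw [← h]; exact f.2 t
      · exact Submodule.zero_mem _⟩ : 𝓕.rees) := by
    refine Subtype.ext ?_
    rw [AddSubmonoidClass.coe_finsetSum]
    exact (AddMonoidAlgebra.sum_coeff_single f.1).symm
  rw [hf, map_sum]
  exact Submodule.sum_mem _ fun t _ => Submodule.subset_span ⟨t, ⟨_, f.2 t⟩, rfl⟩

end RealFiltration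

section Weights

open MvPolynomial

variable {σ : Type*} {d : σ → ℝ} {I : Ideal (MvPolynomial σ ℂ)}

theorem isSymbol_grCoord (d : σ → ℝ) (I : Ideal (MvPolynomial σ ℂ)) (j : σ) :
    (weightFiltration d I).IsSymbol (d j) (Ideal.Quotient.mk I (X j)) (grCoord d I j) :=
  ⟨_, rfl⟩

theorem isSymbol_monomial (d : σ → ℝ) (I : Ideal (MvPolynomial σ ℂ)) (μ : σ →₀ ℕ) (c : ℂ) :
    (weightFiltration d I).IsSymbol (Finsupp.weight d μ) (Ideal.Quotient.mk I (monomial μ c))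
      (c • μ.prod fun j e => grCoord d I j ^ e) := by
  have h : Ideal.Quotient.mk I (monomial μ c) =
      algebraMap ℂ _ c * ∏ j ∈ μ.support, Ideal.Quotient.mk I (X j) ^ μ j := by
    rw [monomial_eq, map_mul, Finsupp.prod, map_prod]
    simp only [map_pow]
    rfl
  rw [h, Finsupp.weight_apply, ← Algebra.smul_def]
  simp only [Finsupp.sum, nsmul_eq_mul]
  exact (RealFiltration.IsSymbol.prod _ fun j _ => (isSymbol_grCoord d I j).pow _).smul c

theorem mk_mem_lt {t : ℝ} {P : MvPolynomial σ ℂ} (hP : ∀ μ ∈ P.support, Finsupp.weight d μ < t) :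
    Ideal.Quotient.mk I P ∈ (weightFiltration d I).lt t := by
  rw [as_sum P, map_sum]
  exact Submodule.sum_mem _ fun μ hμ => ⟨_, hP μ hμ, (isSymbol_monomial d I μ _).1⟩

/-- The homogeneous elements of degree `t` are the combinations of the monomials of weight `t`. -/
theorem mem_span_of_symbol {t : ℝ} (a : (weightFiltration d I).F t) :
    (weightFiltration d I).symbol t a ∈ Submodule.span ℂ
      {g | ∃ μ : σ →₀ ℕ, Finsupp.weight d μ = t ∧ g = μ.prod fun j e => grCoord d I j ^ e} := by
  classical
  obtain ⟨a, P, hP, rfl⟩ := a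
  have h1 : (weightFiltration d I).IsSymbol t
      (∑ μ ∈ P.support with Finsupp.weight d μ = t, Ideal.Quotient.mk I (monomial μ (coeff μ P)))
      (∑ μ ∈ P.support with Finsupp.weight d μ = t,
        coeff μ P • μ.prod fun j e => grCoord d I j ^ e) := by
    refine RealFiltration.IsSymbol.sum _ fun μ hμ => ?_
    have := isSymbol_monomial d I μ (coeff μ P)
    rwa [(Finset.mem_filter.1 hμ).2] at this
  have h2 : (weightFiltration d I).IsSymbol t (Ideal.Quotient.mk I P)
      ((weightFiltration d I).symbol t ⟨_, P, hP, rfl⟩) := ⟨_, rfl⟩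
  rw [h2.eq_of_sub_mem h1]
  · refine Submodule.sum_mem _ fun μ hμ => Submodule.smul_mem _ _ (Submodule.subset_span ?_)
    exact ⟨μ, (Finset.mem_filter.1 hμ).2, rfl⟩
  · conv in Ideal.Quotient.mk I P => rw [as_sum P, map_sum]
    rw [← Finset.sum_filter_add_sum_filter_not P.support (fun μ => Finsupp.weight d μ = t),
      add_sub_cancel_left]
    refine Submodule.sum_mem _ fun μ hμ => ?_
    obtain ⟨hμ, hne⟩ := Finset.mem_filter.1 hμ
    exact ⟨_, lt_of_le_of_ne (hP μ hμ) hne, (isSymbol_monomial d I μ _).1⟩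

end Weights

end Symbols

/-! ### Weights of the equations of `X'` -/

section SystemWeights

open MvPolynomial

/-- A bound for the weight of a monomial in `y, z` and in a chain of variables `c 0, …, c i` whose
weights grow so fast that `d (c (j + 1)) > N j * d (c j)`, with exponents smaller than `N j`. -/
theorem weight_le_of_chain {σ : Type*} {d : σ → ℝ} {c : ℕ → σ} {N : ℕ → ℕ} {i : ℕ} {y z : σ}
    {μ : σ →₀ ℕ} {e D : ℝ} (he : e < 0)
    (hstep : ∀ j < i, e + d (c (j + 1)) = N j * d (c j)) (hpos : ∀ j ≤ i, 0 ≤ d (c j))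
    (hN : ∀ j ≤ i, μ (c j) < N j) (hsupp : ∀ w, μ w ≠ 0 → w = y ∨ w = z ∨ ∃ j ≤ i, w = c j)
    (hyz : y ≠ z) (hyc : ∀ j ≤ i, y ≠ c j) (hzc : ∀ j ≤ i, z ≠ c j)
    (hc : ∀ j ≤ i, ∀ j' ≤ i, c j = c j' → j = j') (hy : d y ≤ D) (hz : d z ≤ D) :
    Finsupp.weight d μ ≤ (μ y + μ z : ℕ) * D + N i * d (c i) - d (c 0) := by
  classical
  have h1 : Finsupp.weight d μ = μ y * d y + (μ z * d z +
      ∑ j ∈ Finset.range (i + 1), μ (c j) * d (c j)) := by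
    rw [Finsupp.weight_apply, Finsupp.sum_of_support_subset
      (s := insert y (insert z ((Finset.range (i + 1)).image c))), Finset.sum_insert,
      Finset.sum_insert, Finset.sum_image]
    · simp
    · intro j hj j' hj' h
      simp only [Finset.coe_range, Set.mem_Iio] at hj hj'
      exact hc j (by omega) j' (by omega) h
    · simp only [Finset.mem_image, Finset.mem_range, not_exists, not_and]
      exact fun j hj h => hzc j (by omega) h.symm
    · simp only [Finset.mem_insert, Finset.mem_image, Finset.mem_range, not_or, not_exists, not_and]
      exact ⟨hyz, fun j hj h => hyc j (by omega) h.symm⟩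
    · intro w hw
      rcases hsupp w (Finsupp.mem_support_iff.1 hw) with rfl | rfl | ⟨j, hj, rfl⟩
      · simp
      · simp
      · simp only [Finset.mem_insert, Finset.mem_image, Finset.mem_range]
        exact .inr (.inr ⟨j, by omega, rfl⟩)
    · simp
  have h2 : ∀ s ≤ i, ∑ j ∈ Finset.range (s + 1), (μ (c j) : ℝ) * d (c j) ≤
      N s * d (c s) - d (c 0) := by
    have hterm : ∀ s ≤ i, (μ (c s) : ℝ) * d (c s) ≤ N s * d (c s) - d (c s) := by
      intro s hs
      have h3 : (μ (c s) : ℝ) + 1 ≤ N s := by exact_mod_cast hN s hs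
      nlinarith [mul_le_mul_of_nonneg_right h3 (hpos s hs)]
    intro s hs
    induction s with
    | zero => simpa using hterm 0 hs
    | succ s ih =>
      rw [Finset.sum_range_succ]
      have := ih (by omega)
      have := hterm (s + 1) hs
      have := hstep s (by omega)
      linarith
  have h3 := h2 i le_rfl
  have h4 := mul_le_mul_of_nonneg_left hy (Nat.cast_nonneg (α := ℝ) (μ y))
  have h5 := mul_le_mul_of_nonneg_left hz (Nat.cast_nonneg (α := ℝ) (μ z))
  rw [h1]
  push_cast
  linarith

/-- The coordinates `v_j`, indexed by the natural numbers. -/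
def vCoord {m p : ℕ} {M : Fin p → ℕ} (j : ℕ) : Coord m p M :=
  if h : j < m then .v ⟨j, h⟩ else .x

/-- The coordinates `u_{s,j}`, indexed by the natural numbers `j`. -/
def uCoord {m p : ℕ} {M : Fin p → ℕ} (s : Fin p) (j : ℕ) : Coord m p M :=
  if h : j < M s then .u s ⟨j, h⟩ else .x

namespace SystemData

variable {m p : ℕ} {M : Fin p → ℕ} (S : SystemData m p M)

/-- A bound for the sum of the degrees in `y` and `z` of the polynomials `q_i` and `r_{s,i}`. -/
noncomputable def yzDegree : ℕ :=
  ∑ i, ((S.q i).degreeOf .y + (S.q i).degreeOf .z) +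
    (∑ s, ((S.r₀ s).degreeOf .y + (S.r₀ s).degreeOf .z) +
      ∑ s, ∑ i, ((S.r s i).degreeOf .y + (S.r s i).degreeOf .z))

/-- How big the ratios of the weights of `v_1, u_{s,1}` to the weight of `y` have to be. -/
noncomputable def threshold : ℝ := S.k * S.yzDegree + 1

variable {S}

theorem yz_le_yzDegree_q {i : Fin m} {μ : Coord m p M →₀ ℕ} (hμ : μ ∈ (S.q i).support) :
    μ .y + μ .z ≤ S.yzDegree := by
  have h1 := monomial_le_degreeOf .y hμ
  have h2 := monomial_le_degreeOf .z hμ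
  have h3 := Finset.single_le_sum_of_canonicallyOrdered
    (f := fun i => (S.q i).degreeOf .y + (S.q i).degreeOf .z) (Finset.mem_univ i)
  unfold yzDegree
  omega

theorem yz_le_yzDegree_r₀ {s : Fin p} {μ : Coord m p M →₀ ℕ} (hμ : μ ∈ (S.r₀ s).support) :
    μ .y + μ .z ≤ S.yzDegree := by
  have h1 := monomial_le_degreeOf .y hμ
  have h2 := monomial_le_degreeOf .z hμ
  have h3 := Finset.single_le_sum_of_canonicallyOrdered
    (f := fun s => (S.r₀ s).degreeOf .y + (S.r₀ s).degreeOf .z) (Finset.mem_univ s)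
  unfold yzDegree
  omega

theorem yz_le_yzDegree_r {s : Fin p} {i : Fin (M s)} {μ : Coord m p M →₀ ℕ}
    (hμ : μ ∈ (S.r s i).support) : μ .y + μ .z ≤ S.yzDegree := by
  have h1 := monomial_le_degreeOf .y hμ
  have h2 := monomial_le_degreeOf .z hμ
  have h3 := Finset.single_le_sum_of_canonicallyOrdered
    (f := fun i => (S.r s i).degreeOf .y + (S.r s i).degreeOf .z) (Finset.mem_univ i)
  have h4 := Finset.single_le_sum_of_canonicallyOrdered
    (f := fun s => ∑ i, ((S.r s i).degreeOf .y + (S.r s i).degreeOf .z)) (Finset.mem_univ s)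
  unfold yzDegree
  omega

theorem mem_of_mem_supported {σ : Type*} {P : MvPolynomial σ ℂ} {s : Set σ}
    (hP : P ∈ supported ℂ s) {μ : σ →₀ ℕ} (hμ : μ ∈ P.support) {w : σ} (hw : μ w ≠ 0) : w ∈ s :=
  mem_supported.1 hP ((mem_vars_iff_mem_support w).2 ⟨μ, hμ, Finsupp.mem_support_iff.2 hw⟩)

namespace IsAdmissible

variable {C : ℝ} {d : Coord m p M → ℝ}

theorem z_le (h : S.IsAdmissible C d) : d .z ≤ S.k * d .y := by
  have h1 := h.y_z
  have h2 := S.two_le_l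
  have h3 : (2 : ℝ) ≤ S.l := by exact_mod_cast h2
  have h4 : (0 : ℝ) ≤ S.k * d .y := mul_nonneg (Nat.cast_nonneg _) h.y_pos.le
  nlinarith

theorem y_le (h : S.IsAdmissible C d) : d .y ≤ S.k * d .y := by
  have h1 := S.two_le_l
  have h2 := S.l_lt_k
  have h3 : (1 : ℝ) ≤ S.k := by exact_mod_cast (by omega : 1 ≤ S.k)
  nlinarith [h.y_pos]

theorem yz_part_lt (h : S.IsAdmissible S.threshold d) {j : ℕ} (hj : j ≤ S.yzDegree) :
    (j : ℝ) * (S.k * d .y) < S.threshold * d .y := by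
  have h1 : (j : ℝ) ≤ S.yzDegree := by exact_mod_cast hj
  have h2 : (0 : ℝ) ≤ S.k * d .y := mul_nonneg (Nat.cast_nonneg _) h.y_pos.le
  have h3 := mul_le_mul_of_nonneg_right h1 h2
  have h4 := h.y_pos
  unfold threshold
  nlinarith

theorem threshold_mul_pos (h : S.IsAdmissible S.threshold d) : 0 < S.threshold * d .y := by
  simpa using h.yz_part_lt (Nat.zero_le _)

theorem v_pos (h : S.IsAdmissible S.threshold d) (i : Fin m) : 0 < d (.v i) := by
  obtain ⟨i, hi⟩ := i
  induction i with
  | zero => exact h.threshold_mul_pos.trans_le (h.v_large _ rfl)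
  | succ i ih =>
    have h1 := h.v_next ⟨i, by omega⟩ ⟨i + 1, hi⟩ rfl
    have h2 := mul_nonneg (Nat.cast_nonneg (α := ℝ) (S.n ⟨i, by omega⟩)) (ih (by omega)).le
    have h3 := h.x_neg
    linarith

theorem u_pos (h : S.IsAdmissible S.threshold d) (s : Fin p) (i : Fin (M s)) :
    0 < d (.u s i) := by
  obtain ⟨i, hi⟩ := i
  induction i with
  | zero => exact h.threshold_mul_pos.trans_le (h.u_large _ _ rfl)
  | succ i ih =>
    have h1 := h.u_next s ⟨i, by omega⟩ ⟨i + 1, hi⟩ rfl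
    have h2 := mul_nonneg (Nat.cast_nonneg (α := ℝ) (S.N s ⟨i, by omega⟩)) (ih (by omega)).le
    have h3 := h.x_neg
    linarith

theorem weight_q_lt (h : S.IsAdmissible S.threshold d) {i : Fin m} (hi : (i : ℕ) + 1 < m)
    {μ : Coord m p M →₀ ℕ} (hμ : μ ∈ (S.q i).support) :
    Finsupp.weight d μ < S.n i * d (.v i) := by
  have hc : ∀ j (hj : j < m), vCoord j = (.v ⟨j, hj⟩ : Coord m p M) := fun j hj => dif_pos hj
  let N : ℕ → ℕ := fun j => if hj : j < m then S.n ⟨j, hj⟩ else 0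
  have hN : ∀ j (hj : j < m), N j = S.n ⟨j, hj⟩ := fun j hj => dif_pos hj
  have key := weight_le_of_chain (d := d) (c := vCoord) (N := N) (i := i) (y := .y) (z := .z)
    (μ := μ) h.x_neg (D := S.k * d .y)
    (fun j hj => by
      rw [hc j (by omega), hc (j + 1) (by omega), hN j (by omega)]
      exact h.v_next _ _ rfl)
    (fun j hj => by rw [hc j (by omega)]; exact (h.v_pos _).le)
    (fun j hj => by
      rw [hc j (by omega), hN j (by omega)]
      exact (monomial_le_degreeOf _ hμ).trans_lt (S.q_degree i ⟨j, by omega⟩ hi hj))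
    (fun w hw => by
      rcases mem_of_mem_supported (S.q_supported i hi) hμ hw with (rfl | rfl) | ⟨j, hj, rfl⟩
      · exact .inl rfl
      · exact .inr (.inl rfl)
      · exact .inr (.inr ⟨j, hj, (hc j j.2).symm⟩))
    (by simp) (fun j hj => by rw [hc j (by omega)]; simp)
    (fun j hj => by rw [hc j (by omega)]; simp)
    (fun j hj j' hj' hjj' => by
      rw [hc j (by omega), hc j' (by omega)] at hjj'
      simpa using hjj') h.y_le h.z_le
  rw [hc i i.2, hN i i.2, hc 0 (by omega)] at key
  have h1 := h.yz_part_lt (yz_le_yzDegree_q hμ)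
  have h2 := h.v_large ⟨0, by omega⟩ rfl
  linarith

theorem weight_r₀_lt (h : S.IsAdmissible S.threshold d) {s : Fin p} {i : Fin (M s)}
    (hi : (i : ℕ) = 0) {μ : Coord m p M →₀ ℕ} (hμ : μ ∈ (S.r₀ s).support) :
    Finsupp.weight d μ < d (.u s i) := by
  classical
  have h0 : Finsupp.weight d μ = μ .y * d .y + μ .z * d .z := by
    rw [Finsupp.weight_apply, Finsupp.sum_of_support_subset (s := {.y, .z}),
      Finset.sum_pair (by simp)]
    · simp
    · intro w hw
      rcases mem_of_mem_supported (S.r₀_supported s) hμ (Finsupp.mem_support_iff.1 hw) with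
        rfl | rfl
      · simp
      · simp
    · simp
  have h1 := h.yz_part_lt (yz_le_yzDegree_r₀ hμ)
  have h2 := h.u_large s i hi
  have h3 := mul_le_mul_of_nonneg_left h.y_le (Nat.cast_nonneg (α := ℝ) (μ .y))
  have h4 := mul_le_mul_of_nonneg_left h.z_le (Nat.cast_nonneg (α := ℝ) (μ .z))
  push_cast at h1
  linarith

theorem weight_r_lt (h : S.IsAdmissible S.threshold d) {s : Fin p} {i : Fin (M s)}
    (hi : (i : ℕ) + 1 < M s) {μ : Coord m p M →₀ ℕ} (hμ : μ ∈ (S.r s i).support) :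
    Finsupp.weight d μ < S.N s i * d (.u s i) := by
  have hc : ∀ j (hj : j < M s), uCoord s j = (.u s ⟨j, hj⟩ : Coord m p M) :=
    fun j hj => dif_pos hj
  let N : ℕ → ℕ := fun j => if hj : j < M s then S.N s ⟨j, hj⟩ else 0
  have hN : ∀ j (hj : j < M s), N j = S.N s ⟨j, hj⟩ := fun j hj => dif_pos hj
  have key := weight_le_of_chain (d := d) (c := uCoord s) (N := N) (i := i) (y := .y) (z := .z)
    (μ := μ) h.x_neg (D := S.k * d .y)
    (fun j hj => by
      rw [hc j (by omega), hc (j + 1) (by omega), hN j (by omega)]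
      exact h.u_next s _ _ rfl)
    (fun j hj => by rw [hc j (by omega)]; exact (h.u_pos s _).le)
    (fun j hj => by
      rw [hc j (by omega), hN j (by omega)]
      exact (monomial_le_degreeOf _ hμ).trans_lt (S.r_degree s i ⟨j, by omega⟩ hi hj))
    (fun w hw => by
      rcases mem_of_mem_supported (S.r_supported s i hi) hμ hw with (rfl | rfl) | ⟨j, hj, rfl⟩
      · exact .inl rfl
      · exact .inr (.inl rfl)
      · exact .inr (.inr ⟨j, hj, (hc j j.2).symm⟩))
    (by simp) (fun j hj => by rw [hc j (by omega)]; simp)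
    (fun j hj => by rw [hc j (by omega)]; simp)
    (fun j hj j' hj' hjj' => by
      rw [hc j (by omega), hc j' (by omega)] at hjj'
      simpa using hjj') h.y_le h.z_le
  rw [hc i i.2, hN i i.2, hc 0 (by omega)] at key
  have h1 := h.yz_part_lt (yz_le_yzDegree_r hμ)
  have h2 := h.u_large s ⟨0, by omega⟩ rfl
  linarith

end IsAdmissible

/-! ### The relations in the associated graded algebra -/

theorem mk_eq_zero_of_isEquation {f : MvPolynomial (Coord m p M) ℂ} (hf : S.IsEquation f) :
    Ideal.Quotient.mk S.ideal f = 0 :=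
  Ideal.Quotient.eq_zero_iff_mem.2 fun P hP => by
    have := hP f hf
    rwa [← coe_aeval_eq_eval] at this

variable {d : Coord m p M → ℝ}

theorem coord_v_first (h : S.IsAdmissible S.threshold d) {i : Fin m} (hi : (i : ℕ) = 0) :
    S.coord d .x * S.coord d (.v i) = S.coord d .y ^ S.k - S.coord d .z ^ S.l := by
  have h1 := (isSymbol_grCoord d S.ideal .x).mul (isSymbol_grCoord d S.ideal (.v i))
  have h2 := ((isSymbol_grCoord d S.ideal .y).pow S.k)
  have h3 := ((isSymbol_grCoord d S.ideal .z).pow S.l)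
  rw [← h.y_z] at h3
  rw [add_comm, h.v_first i hi] at h1
  refine h1.eq_of_sub_mem (h2.sub h3) ?_
  have h4 := mk_eq_zero_of_isEquation (.v_first i hi : S.IsEquation _)
  simp only [map_sub, map_mul, map_pow] at h4
  rw [h4]
  exact Submodule.zero_mem _

theorem coord_v_next (h : S.IsAdmissible S.threshold d) {i i' : Fin m} (hi : (i' : ℕ) = i + 1) :
    S.coord d .x * S.coord d (.v i') = S.coord d (.v i) ^ S.n i := by
  have h1 := (isSymbol_grCoord d S.ideal .x).mul (isSymbol_grCoord d S.ideal (.v i'))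
  have h2 := ((isSymbol_grCoord d S.ideal (.v i)).pow (S.n i))
  rw [h.v_next i i' hi] at h1
  refine h1.eq_of_sub_mem h2 ?_
  have h4 := mk_eq_zero_of_isEquation (.v_next i i' hi : S.IsEquation _)
  simp only [map_add, map_sub, map_mul, map_pow] at h4
  rw [eq_neg_of_add_eq_zero_left h4]
  exact Submodule.neg_mem _ (mk_mem_lt fun μ hμ => h.weight_q_lt (by omega) hμ)

/-- Near `x = 0` the equation `(x - c) * u = f` gives `u` a smaller order than its weight. -/
theorem grCoord_eq_zero {σ : Type*} {d : σ → ℝ} {I : Ideal (MvPolynomial σ ℂ)} {x u : σ} {c : ℂ}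
    {f : MvPolynomial σ ℂ} (hc : c ≠ 0) (hx : d x < 0)
    (hf : Ideal.Quotient.mk I f ∈ (weightFiltration d I).lt (d u))
    (hu : Ideal.Quotient.mk I ((X x - C c) * X u - f) = 0) : grCoord d I u = 0 := by
  refine (isSymbol_grCoord d I u).eq_zero ?_
  have h1 : Ideal.Quotient.mk I (X x * X u) ∈ (weightFiltration d I).lt (d u) := by
    rw [map_mul]
    exact ⟨d x + d u, by linarith, ((isSymbol_grCoord d I x).mul (isSymbol_grCoord d I u)).1⟩
  have h2 := Submodule.smul_mem _ c⁻¹ (Submodule.sub_mem _ h1 hf)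
  have h3 : c⁻¹ • (X x * X u - f) = X u + c⁻¹ • ((X x - C c) * X u - f) := by
    have h4 : (C c⁻¹ * C c : MvPolynomial σ ℂ) = 1 := by
      rw [← C_mul, inv_mul_cancel₀ hc, C_1]
    rw [smul_eq_C_mul, smul_eq_C_mul]
    linear_combination X u * h4
  have h5 := congrArg (Ideal.Quotient.mkₐ ℂ I) h3
  rw [map_smul, map_add, map_smul] at h5
  simp only [Ideal.Quotient.mkₐ_eq_mk] at h5
  rw [hu, smul_zero, add_zero, map_sub] at h5
  rw [← h5]
  exact h2

theorem coord_u_first (h : S.IsAdmissible S.threshold d) {s : Fin p} {i : Fin (M s)}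
    (hi : (i : ℕ) = 0) : S.coord d (.u s i) = 0 :=
  grCoord_eq_zero (S.c_ne_zero s) h.x_neg (mk_mem_lt fun _ hμ => h.weight_r₀_lt hi hμ)
    (mk_eq_zero_of_isEquation (.u_first s i hi))

theorem coord_u_next (h : S.IsAdmissible S.threshold d) {s : Fin p} {i i' : Fin (M s)}
    (hi : (i' : ℕ) = i + 1) : S.coord d (.u s i') = 0 := by
  have hw := h.u_next s i i' hi
  have hx := h.x_neg
  refine grCoord_eq_zero (f := X (.u s i) ^ S.N s i - S.r s i) (S.c_ne_zero s) hx ?_ ?_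
  · rw [map_sub, map_pow]
    refine Submodule.sub_mem _ ⟨_, ?_, ((isSymbol_grCoord d S.ideal (.u s i)).pow (S.N s i)).1⟩
      (mk_mem_lt fun μ hμ => ?_)
    · linarith
    · have := h.weight_r_lt (by omega) hμ
      linarith
  · rw [← mk_eq_zero_of_isEquation (.u_next s i i' hi : S.IsEquation _)]
    congr 1
    ring

theorem coord_u (h : S.IsAdmissible S.threshold d) (s : Fin p) (i : Fin (M s)) :
    S.coord d (.u s i) = 0 := by
  obtain ⟨_ | i, hi⟩ := i
  · exact coord_u_first h rfl
  · exact coord_u_next h (i := ⟨i, by omega⟩) rfl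

end SystemData

end SystemWeights

/-! ### Characters of the associated graded algebra as limits -/

section Limits

open MvPolynomial Filter Topology

/-- `f τ` grows at most like `exp (τ * s)`, in the strong sense that the quotient has a limit. -/
def HasExpOrder (f : ℝ → ℂ) (s : ℝ) : Prop :=
  ∃ L : ℂ, Tendsto (fun τ : ℝ => f τ * (Real.exp (-(τ * s)) : ℂ)) atTop (𝓝 L)

namespace HasExpOrder

variable {f g : ℝ → ℂ} {s t : ℝ}

theorem mul (hf : HasExpOrder f s) (hg : HasExpOrder g t) :
    HasExpOrder (fun τ => f τ * g τ) (s + t) := by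
  obtain ⟨L, hL⟩ := hf
  obtain ⟨L', hL'⟩ := hg
  refine ⟨L * L', (hL.mul hL').congr fun τ => ?_⟩
  rw [mul_add, neg_add, Real.exp_add, Complex.ofReal_mul]
  ring

theorem of_tendsto {L : ℂ} (h : Tendsto f atTop (𝓝 L)) : HasExpOrder f 0 := ⟨L, by simpa using h⟩

theorem mul_tendsto (hf : HasExpOrder f s) {L : ℂ} (h : Tendsto g atTop (𝓝 L)) :
    HasExpOrder (fun τ => f τ * g τ) s := by
  simpa using hf.mul (of_tendsto h)

theorem pow (hf : HasExpOrder f s) (n : ℕ) : HasExpOrder (fun τ => f τ ^ n) (n * s) := by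
  induction n with
  | zero => simpa using of_tendsto (tendsto_const_nhds (x := (1 : ℂ)))
  | succ n ih =>
    simp only [pow_succ]
    rw [Nat.cast_succ, add_mul, one_mul]
    exact ih.mul hf

theorem add (hf : HasExpOrder f s) (hg : HasExpOrder g s) :
    HasExpOrder (fun τ => f τ + g τ) s := by
  obtain ⟨L, hL⟩ := hf
  obtain ⟨L', hL'⟩ := hg
  exact ⟨L + L', (hL.add hL').congr fun τ => by ring⟩

theorem sub (hf : HasExpOrder f s) (hg : HasExpOrder g s) :
    HasExpOrder (fun τ => f τ - g τ) s := by
  obtain ⟨L, hL⟩ := hf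
  obtain ⟨L', hL'⟩ := hg
  exact ⟨L - L', (hL.sub hL').congr fun τ => by ring⟩

theorem congr' (hf : HasExpOrder f s) (h : f =ᶠ[atTop] g) : HasExpOrder g s := by
  obtain ⟨L, hL⟩ := hf
  refine ⟨L, hL.congr' ?_⟩
  filter_upwards [h] with τ hτ
  rw [hτ]

theorem prod {ι : Type*} (S : Finset ι) {f : ι → ℝ → ℂ} {s : ι → ℝ}
    (h : ∀ i ∈ S, HasExpOrder (f i) (s i)) :
    HasExpOrder (fun τ => ∏ i ∈ S, f i τ) (∑ i ∈ S, s i) := by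
  classical
  induction S using Finset.induction_on with
  | empty => simpa using of_tendsto (tendsto_const_nhds (x := (1 : ℂ)))
  | insert i S hi ih =>
    simp only [Finset.prod_insert hi]
    rw [Finset.sum_insert hi]
    exact (h i (by simp)).mul (ih fun j hj => h j (by simp [hj]))

theorem sum {ι : Type*} (S : Finset ι) {f : ι → ℝ → ℂ} (h : ∀ i ∈ S, HasExpOrder (f i) s) :
    HasExpOrder (fun τ => ∑ i ∈ S, f i τ) s := by
  classical
  induction S using Finset.induction_on with
  | empty => exact ⟨0, by simp⟩
  | insert i S hi ih =>
    simp only [Finset.sum_insert hi]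
    exact (h i (by simp)).add (ih fun j hj => h j (by simp [hj]))

theorem tendsto_zero (hf : HasExpOrder f s) (hst : s < t) :
    Tendsto (fun τ : ℝ => f τ * (Real.exp (-(τ * t)) : ℂ)) atTop (𝓝 0) := by
  obtain ⟨L, hL⟩ := hf
  have h1 : Tendsto (fun τ : ℝ => Real.exp (-(τ * (t - s)))) atTop (𝓝 0) :=
    Real.tendsto_exp_neg_atTop_nhds_zero.comp (tendsto_id.atTop_mul_const (sub_pos.2 hst))
  have h2 := hL.mul ((Complex.continuous_ofReal.tendsto 0).comp h1)
  rw [Complex.ofReal_zero, mul_zero] at h2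
  refine h2.congr fun τ => ?_
  simp only [Function.comp_apply]
  rw [mul_assoc, ← Complex.ofReal_mul, ← Real.exp_add]
  ring_nf

theorem mono (hf : HasExpOrder f s) (hst : s ≤ t) : HasExpOrder f t := by
  rcases hst.lt_or_eq with h | rfl
  · exact ⟨0, hf.tendsto_zero h⟩
  · exact hf

theorem exp (a : ℂ) (s : ℝ) : HasExpOrder (fun τ => (Real.exp (τ * s) : ℂ) * a) s := by
  refine ⟨a, tendsto_const_nhds.congr fun τ => ?_⟩
  rw [mul_right_comm, ← Complex.ofReal_mul, ← Real.exp_add]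
  simp

theorem eval {σ : Type*} {P : ℝ → σ → ℂ} {d : σ → ℝ} {Q : MvPolynomial σ ℂ}
    (hP : ∀ μ ∈ Q.support, ∀ j, μ j ≠ 0 → HasExpOrder (fun τ => P τ j) (d j))
    (hQ : ∀ μ ∈ Q.support, Finsupp.weight d μ ≤ s) :
    HasExpOrder (fun τ => MvPolynomial.eval (P τ) Q) s := by
  simp only [eval_eq]
  refine HasExpOrder.sum _ fun μ hμ => ?_
  refine HasExpOrder.mono ?_ (hQ μ hμ)
  have h1 := HasExpOrder.prod μ.support fun j hj =>
    (hP μ hμ j (Finsupp.mem_support_iff.1 hj)).pow (μ j)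
  have h2 := h1.mul_tendsto (tendsto_const_nhds (x := coeff μ Q))
  rw [Finsupp.weight_apply, Finsupp.sum]
  simp only [nsmul_eq_mul]
  simpa only [mul_comm] using h2

end HasExpOrder

theorem exists_limit_algHom {R : Type*} [CommRing R] [Algebra ℂ R] (Ψ : ℝ → R →ₐ[ℂ] ℂ)
    (h : ∀ r, ∃ L, Tendsto (fun τ => Ψ τ r) atTop (𝓝 L)) :
    ∃ Φ : R →ₐ[ℂ] ℂ, ∀ r, Tendsto (fun τ => Ψ τ r) atTop (𝓝 (Φ r)) := by
  choose L hL using h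
  refine ⟨{ toFun := L, map_one' := ?_, map_mul' := fun a b => ?_, map_zero' := ?_,
            map_add' := fun a b => ?_, commutes' := fun c => ?_ }, hL⟩
  · exact tendsto_nhds_unique (hL 1) (by simp)
  · exact tendsto_nhds_unique (hL _) (by simpa using (hL a).mul (hL b))
  · exact tendsto_nhds_unique (hL 0) (by simp)
  · exact tendsto_nhds_unique (hL _) (by simpa using (hL a).add (hL b))
  · exact tendsto_nhds_unique (hL _) (by simp)

/-- Let `P τ` be points of `V` whose coordinates `j` grow like `exp (τ * d j)`. Then the limits of
`exp (-τ * t) * a (P τ)`, for `a` of degree at most `t`, define a character of the associated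
graded algebra. -/
theorem exists_character {σ : Type*} {V : Set (σ → ℂ)} {P : ℝ → σ → ℂ} (hP : ∀ τ, P τ ∈ V)
    {d : σ → ℝ} (hd : ∀ j, HasExpOrder (fun τ => P τ j) (d j)) :
    ∃ φ : (weightFiltration d (vanishingIdeal ℂ V)).Gr →ₐ[ℂ] ℂ, ∀ j,
      Tendsto (fun τ : ℝ => P τ j * (Real.exp (-(τ * d j)) : ℂ)) atTop
        (𝓝 (φ (grCoord d (vanishingIdeal ℂ V) j))) := by
  let A := MvPolynomial σ ℂ ⧸ vanishingIdeal ℂ V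
  let 𝓕 : RealFiltration A := weightFiltration d (vanishingIdeal ℂ V)
  let ev : ∀ τ : ℝ, A →ₐ[ℂ] ℂ := fun τ =>
    Ideal.Quotient.liftₐ (vanishingIdeal ℂ V) (aeval (P τ)) fun f hf => hf (P τ) (hP τ)
  have hev : ∀ τ Q, ev τ (Ideal.Quotient.mk _ Q) = MvPolynomial.eval (P τ) Q := by
    intro τ Q
    rw [← coe_aeval_eq_eval]
    rfl
  let e : ∀ τ : ℝ, Multiplicative ℝ →* ℂ := fun τ =>
    { toFun := fun t => (Real.exp (-(τ * t.toAdd)) : ℂ)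
      map_one' := by simp
      map_mul' := fun s t => by
        rw [toAdd_mul, mul_add, neg_add, Real.exp_add, Complex.ofReal_mul] }
  let Ψ : ℝ → AddMonoidAlgebra A ℝ →ₐ[ℂ] ℂ := fun τ =>
    AddMonoidAlgebra.liftNCAlgHom (ev τ) (e τ) fun _ _ => Commute.all _ _
  have hΨ : ∀ τ t a, Ψ τ (AddMonoidAlgebra.single t a) = ev τ a * (Real.exp (-(τ * t)) : ℂ) :=
    fun τ t a => AddMonoidAlgebra.liftNC_single _ _ _ _
  have hF : ∀ t, ∀ a ∈ 𝓕.F t, HasExpOrder (fun τ => ev τ a) t := by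
    rintro t _ ⟨Q, hQ, rfl⟩
    simp only [hev]
    exact HasExpOrder.eval (fun _ _ j _ => hd j) hQ
  have hsum : ∀ (f : AddMonoidAlgebra A ℝ) τ,
      Ψ τ f = ∑ t ∈ f.coeff.support, ev τ (f.coeff t) * (Real.exp (-(τ * t)) : ℂ) := by
    intro f τ
    conv_lhs => rw [← AddMonoidAlgebra.sum_coeff_single f, Finsupp.sum, map_sum]
    exact Finset.sum_congr rfl fun t _ => hΨ τ t _
  obtain ⟨Φ, hΦ⟩ := exists_limit_algHom (R := 𝓕.rees) (fun τ => (Ψ τ).comp 𝓕.rees.val) fun f => by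
    choose L hL using fun t => hF t _ (f.2 t)
    refine ⟨∑ t ∈ f.1.coeff.support, L t, (tendsto_finsetSum _ fun t _ => hL t).congr fun τ => ?_⟩
    exact (hsum f.1 τ).symm
  have hker : ∀ f ∈ 𝓕.reesLt, Φ f = 0 := by
    intro f hf
    refine tendsto_nhds_unique (hΦ f) ?_
    have : Tendsto (fun τ : ℝ => ∑ t ∈ f.1.coeff.support,
        ev τ (f.1.coeff t) * (Real.exp (-(τ * t)) : ℂ)) atTop (𝓝 (∑ t ∈ f.1.coeff.support, 0)) := by
      refine tendsto_finsetSum _ fun t _ => ?_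
      obtain ⟨s, hs, h⟩ := hf t
      exact (hF s _ h).tendsto_zero hs
    rw [Finset.sum_const_zero] at this
    exact this.congr fun τ => (hsum f.1 τ).symm
  refine ⟨Ideal.Quotient.liftₐ 𝓕.reesLt Φ hker, fun j => ?_⟩
  refine (hΦ ⟨AddMonoidAlgebra.single (d j) (Ideal.Quotient.mk _ (X j)), _⟩).congr fun τ => ?_
  refine (hΨ τ (d j) _).trans ?_
  rw [hev, eval_X]

end Limits

/-! ### Points of `X'` -/

section Points

open MvPolynomial Filter Topology

namespace SystemData

variable {m p : ℕ} {M : Fin p → ℕ} {S : SystemData m p M}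

/-- The equations of `X'`, solved for the variable in which they are linear: the right-hand sides
are evaluated at `P`, and `x, y, z` are replaced by `a, b, c`. -/
noncomputable def solveStep (S : SystemData m p M) (a b c : ℂ) (P : Coord m p M → ℂ) :
    Coord m p M → ℂ
  | .x => a
  | .y => b
  | .z => c
  | .v ⟨0, _⟩ => (b ^ S.k - c ^ S.l) / a
  | .v ⟨i + 1, hi⟩ => (P (.v ⟨i, by omega⟩) ^ S.n ⟨i, by omega⟩ -
      eval P (S.q ⟨i, by omega⟩)) / a
  | .u s ⟨0, _⟩ => eval P (S.r₀ s) / (a - S.c s)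
  | .u s ⟨i + 1, hi⟩ => (P (.u s ⟨i, by omega⟩) ^ S.N s ⟨i, by omega⟩ -
      eval P (S.r s ⟨i, by omega⟩)) / (a - S.c s)

/-- The order in which the coordinates of a point of `X'` are computed. -/
def coordRank : Coord m p M → ℕ
  | .x => 0
  | .y => 0
  | .z => 0
  | .v i => i + 1
  | .u _ i => i + 1

theorem eval_congr_of_supported {σ : Type*} {Q : MvPolynomial σ ℂ} {s : Set σ}
    (hQ : Q ∈ supported ℂ s) {P P' : σ → ℂ} (h : ∀ w ∈ s, P w = P' w) : eval P Q = eval P' Q :=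
  eval₂Hom_congr' rfl (fun w hw _ => h w (mem_supported.1 hQ hw)) rfl

theorem solveStep_congr (a b c : ℂ) {P P' : Coord m p M → ℂ} {w : Coord m p M}
    (h : ∀ w', coordRank w' < coordRank w → P w' = P' w') :
    S.solveStep a b c P w = S.solveStep a b c P' w := by
  match w with
  | .x => rfl
  | .y => rfl
  | .z => rfl
  | .v ⟨0, _⟩ => rfl
  | .v ⟨i + 1, hi⟩ =>
    have h1 : eval P (S.q ⟨i, by omega⟩) = eval P' (S.q ⟨i, by omega⟩) := by
      refine eval_congr_of_supported (S.q_supported _ hi) fun w' hw' => h w' ?_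
      rcases hw' with (rfl | rfl) | ⟨j, hj, rfl⟩
      · simp [coordRank]
      · simp [coordRank]
      · have : (j : ℕ) ≤ i := hj
        simp only [coordRank]
        omega
    simp only [solveStep]
    rw [h1, h (.v ⟨i, by omega⟩) (by simp [coordRank])]
  | .u s ⟨0, _⟩ =>
    have h1 : eval P (S.r₀ s) = eval P' (S.r₀ s) := by
      refine eval_congr_of_supported (S.r₀_supported _) fun w' hw' => h w' ?_
      rcases hw' with rfl | rfl <;> simp [coordRank]
    simp only [solveStep]
    rw [h1]
  | .u s ⟨i + 1, hi⟩ =>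
    have h1 : eval P (S.r s ⟨i, by omega⟩) = eval P' (S.r s ⟨i, by omega⟩) := by
      refine eval_congr_of_supported (S.r_supported _ _ hi) fun w' hw' => h w' ?_
      rcases hw' with (rfl | rfl) | ⟨j, hj, rfl⟩
      · simp [coordRank]
      · simp [coordRank]
      · have : (j : ℕ) ≤ i := hj
        simp only [coordRank]
        omega
    simp only [solveStep]
    rw [h1, h (.u s ⟨i, by omega⟩) (by simp [coordRank])]

theorem coordRank_le (w : Coord m p M) : coordRank w ≤ m + ∑ s, M s := by
  match w with
  | .x => simp [coordRank]
  | .y => simp [coordRank]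
  | .z => simp [coordRank]
  | .v i => simp only [coordRank]; omega
  | .u s i =>
    have := Finset.single_le_sum_of_canonicallyOrdered (f := M) (Finset.mem_univ s)
    simp only [coordRank]
    omega

/-- The coordinates `x, y, z` of a point of `X'` are arbitrary, as long as `x ≠ 0` and
`x ≠ c_s` for all `s`. -/
theorem exists_mem_variety (S : SystemData m p M) {a : ℂ} (b c : ℂ) (ha : a ≠ 0)
    (hac : ∀ s, a ≠ S.c s) : ∃ P ∈ S.variety, P .x = a ∧ P .y = b ∧ P .z = c := by
  let F := S.solveStep a b c
  have hstab : ∀ N w, coordRank w < N → F^[N + 1] 0 w = F^[N] 0 w := by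
    intro N
    induction N with
    | zero => intro w hw; omega
    | succ N ih =>
      intro w hw
      rw [Function.iterate_succ_apply' F (N + 1)]
      conv_rhs => rw [Function.iterate_succ_apply' F N]
      exact solveStep_congr a b c fun w' hw' => ih w' (by omega)
  obtain ⟨P, hP⟩ : ∃ P, F P = P := by
    refine ⟨F^[m + ∑ s, M s + 1] 0, funext fun w => ?_⟩
    rw [← Function.iterate_succ_apply' F]
    exact hstab _ w (by have := coordRank_le w; omega)
  have hx : P .x = a := by rw [← hP]; rfl
  have hy : P .y = b := by rw [← hP]; rfl
  have hz : P .z = c := by rw [← hP]; rfl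
  refine ⟨P, ?_, hx, hy, hz⟩
  rintro f (⟨⟨i, hi⟩, h0⟩ | ⟨⟨i, hi⟩, ⟨i', hi'⟩, h1⟩ | ⟨s, ⟨i, hi⟩, h0⟩ |
    ⟨s, ⟨i, hi⟩, ⟨i', hi'⟩, h1⟩)
  · obtain rfl : i = 0 := h0
    have hv : P (.v ⟨0, hi⟩) = (b ^ S.k - c ^ S.l) / a := by
      conv_lhs => rw [← hP]
      rfl
    simp only [map_sub, map_mul, map_pow, eval_X, hx, hy, hz, hv]
    field_simp
    ring
  · obtain rfl : i' = i + 1 := h1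
    have hv : P (.v ⟨i + 1, hi'⟩) = (P (.v ⟨i, hi⟩) ^ S.n ⟨i, hi⟩ - eval P (S.q ⟨i, hi⟩)) / a := by
      conv_lhs => rw [← hP]
      rfl
    simp only [map_sub, map_add, map_mul, map_pow, eval_X, hx, hv]
    field_simp
    ring
  · obtain rfl : i = 0 := h0
    have hv : P (.u s ⟨0, hi⟩) = eval P (S.r₀ s) / (a - S.c s) := by
      conv_lhs => rw [← hP]
      rfl
    have := sub_ne_zero.2 (hac s)
    simp only [map_sub, map_mul, eval_X, eval_C, hx, hv]
    field_simp
    ring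
  · obtain rfl : i' = i + 1 := h1
    have hv : P (.u s ⟨i + 1, hi'⟩) =
        (P (.u s ⟨i, hi⟩) ^ S.N s ⟨i, hi⟩ - eval P (S.r s ⟨i, hi⟩)) / (a - S.c s) := by
      conv_lhs => rw [← hP]
      rfl
    have := sub_ne_zero.2 (hac s)
    simp only [map_sub, map_add, map_mul, map_pow, eval_X, eval_C, hx, hv]
    field_simp
    ring

/-- The values of `x, y, z` at a character of the associated graded algebra are arbitrary, as long
as `x ≠ 0`. -/
theorem exists_character_coord {d : Coord m p M → ℝ} (h : S.IsAdmissible S.threshold d)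
    {a : ℂ} (b c : ℂ) (ha : a ≠ 0) : ∃ φ : S.GrA d →ₐ[ℂ] ℂ,
      φ (S.coord d .x) = a ∧ φ (S.coord d .y) = b ∧ φ (S.coord d .z) = c := by
  have hne : ∃ a₀ : ℂ, a₀ ≠ 0 ∧ ∀ s, a₀ ≠ S.c s := by
    obtain ⟨a₀, ha₀⟩ := (insert 0 (Set.range S.c)).toFinite.infinite_compl.nonempty
    refine ⟨a₀, fun h0 => ha₀ (.inl h0), fun s hs => ha₀ (.inr ⟨s, hs.symm⟩)⟩
  -- At the finitely many exceptional values of `x` any point of `X'` serves.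
  have hpath : ∀ τ : ℝ, ∃ P ∈ S.variety, (∀ s, (Real.exp (τ * d .x) : ℂ) * a ≠ S.c s) →
      P .x = (Real.exp (τ * d .x) : ℂ) * a ∧ P .y = (Real.exp (τ * d .y) : ℂ) * b ∧
        P .z = (Real.exp (τ * d .z) : ℂ) * c := by
    intro τ
    by_cases hτ : ∀ s, (Real.exp (τ * d .x) : ℂ) * a ≠ S.c s
    · obtain ⟨P, hP, h1⟩ := S.exists_mem_variety ((Real.exp (τ * d .y) : ℂ) * b)
        ((Real.exp (τ * d .z) : ℂ) * c)
        (mul_ne_zero (Complex.ofReal_ne_zero.2 (Real.exp_pos (τ * d .x)).ne') ha) hτ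
      exact ⟨P, hP, fun _ => h1⟩
    · obtain ⟨a₀, h0, hs⟩ := hne
      obtain ⟨P, hP, -⟩ := S.exists_mem_variety 0 0 h0 hs
      exact ⟨P, hP, fun h' => absurd h' hτ⟩
  choose P hPV hPxyz using hpath
  have hx0 : Tendsto (fun τ : ℝ => (Real.exp (τ * d .x) : ℂ) * a) atTop (𝓝 0) := by
    have := (HasExpOrder.exp a (d .x)).tendsto_zero h.x_neg
    simpa using this
  have hgood : ∀ᶠ τ in atTop, ∀ s, (Real.exp (τ * d .x) : ℂ) * a ≠ S.c s :=
    eventually_all.2 fun s => hx0.eventually_ne (S.c_ne_zero s).symm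
  have hPx : (fun τ => (Real.exp (τ * d .x) : ℂ) * a) =ᶠ[atTop] fun τ => P τ .x := by
    filter_upwards [hgood] with τ hτ using (hPxyz τ hτ).1.symm
  have hPy : (fun τ => (Real.exp (τ * d .y) : ℂ) * b) =ᶠ[atTop] fun τ => P τ .y := by
    filter_upwards [hgood] with τ hτ using (hPxyz τ hτ).2.1.symm
  have hPz : (fun τ => (Real.exp (τ * d .z) : ℂ) * c) =ᶠ[atTop] fun τ => P τ .z := by
    filter_upwards [hgood] with τ hτ using (hPxyz τ hτ).2.2.symm
  have hx := (HasExpOrder.exp a (d .x)).congr' hPx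
  have hy := (HasExpOrder.exp b (d .y)).congr' hPy
  have hz := (HasExpOrder.exp c (d .z)).congr' hPz
  have hxinv : HasExpOrder (fun τ => (P τ .x)⁻¹) (-d .x) := by
    refine (HasExpOrder.exp a⁻¹ (-d .x)).congr' ?_
    filter_upwards [hPx] with τ hτ
    rw [← hτ, mul_inv, ← Complex.ofReal_inv, ← Real.exp_neg, mul_neg]
  have hxne : ∀ᶠ τ in atTop, P τ .x ≠ 0 := by
    filter_upwards [hPx] with τ hτ
    rw [← hτ]
    exact mul_ne_zero (Complex.ofReal_ne_zero.2 (Real.exp_pos _).ne') ha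
  have hv : ∀ i (hi : i < m), HasExpOrder (fun τ => P τ (.v ⟨i, hi⟩)) (d (.v ⟨i, hi⟩)) := by
    intro i
    induction i using Nat.strong_induction_on with
    | _ i ih =>
      intro hi
      rcases i with _ | i
      · have h1 := (hy.pow S.k).sub (h.y_z ▸ hz.pow S.l)
        have h2 := h1.mul hxinv
        rw [← h.v_first ⟨0, hi⟩ rfl, add_neg_cancel_right] at h2
        refine h2.congr' ?_
        filter_upwards [hxne] with τ hτ
        have := hPV τ _ (.v_first ⟨0, hi⟩ rfl)
        simp only [map_sub, map_mul, map_pow, eval_X] at this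
        rw [← div_eq_mul_inv, div_eq_iff hτ]
        linear_combination -this
      · have hi' : i < m := by omega
        have h1 : HasExpOrder (fun τ => eval (P τ) (S.q ⟨i, hi'⟩))
            (S.n ⟨i, hi'⟩ * d (.v ⟨i, hi'⟩)) := by
          refine HasExpOrder.eval (fun μ hμ w hw => ?_) fun μ hμ => (h.weight_q_lt hi hμ).le
          rcases mem_of_mem_supported (S.q_supported _ hi) hμ hw with (rfl | rfl) | ⟨j, hj, rfl⟩
          · exact hy
          · exact hz
          · exact ih j (Nat.lt_succ_of_le hj) j.2
        have h2 := (((ih i (by omega) hi').pow (S.n ⟨i, hi'⟩)).sub h1).mul hxinv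
        rw [← h.v_next ⟨i, hi'⟩ ⟨i + 1, hi⟩ rfl, add_comm (d .x), add_neg_cancel_right] at h2
        refine h2.congr' ?_
        filter_upwards [hxne] with τ hτ
        have := hPV τ _ (.v_next ⟨i, hi'⟩ ⟨i + 1, hi⟩ rfl)
        simp only [map_sub, map_add, map_mul, map_pow, eval_X] at this
        rw [← div_eq_mul_inv, div_eq_iff hτ]
        linear_combination -this
  have hPx0 : Tendsto (fun τ => P τ .x) atTop (𝓝 0) := hx0.congr' hPx
  have hxc : ∀ s, Tendsto (fun τ => (P τ .x - S.c s)⁻¹) atTop (𝓝 (0 - S.c s)⁻¹) := fun s =>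
    (hPx0.sub_const _).inv₀ (by simpa using S.c_ne_zero s)
  have hxcne : ∀ s, ∀ᶠ τ in atTop, P τ .x - S.c s ≠ 0 := fun s => by
    filter_upwards [hPx0.eventually_ne (S.c_ne_zero s).symm] with τ hτ using sub_ne_zero.2 hτ
  have hu : ∀ s i (hi : i < M s),
      HasExpOrder (fun τ => P τ (.u s ⟨i, hi⟩)) (d (.u s ⟨i, hi⟩)) := by
    intro s i
    induction i using Nat.strong_induction_on with
    | _ i ih =>
      intro hi
      rcases i with _ | i
      · have h1 : HasExpOrder (fun τ => eval (P τ) (S.r₀ s)) (d (.u s ⟨0, hi⟩)) := by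
          refine HasExpOrder.eval (fun μ hμ w hw => ?_) fun μ hμ => (h.weight_r₀_lt rfl hμ).le
          rcases mem_of_mem_supported (S.r₀_supported s) hμ hw with rfl | rfl
          · exact hy
          · exact hz
        refine (h1.mul_tendsto (hxc s)).congr' ?_
        filter_upwards [hxcne s] with τ hτ
        have := hPV τ _ (.u_first s ⟨0, hi⟩ rfl)
        simp only [map_sub, map_mul, eval_X, eval_C] at this
        rw [← div_eq_mul_inv, div_eq_iff hτ]
        linear_combination -this
      · have hi' : i < M s := by omega
        have hle : S.N s ⟨i, hi'⟩ * d (.u s ⟨i, hi'⟩) ≤ d (.u s ⟨i + 1, hi⟩) := by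
          have := h.u_next s ⟨i, hi'⟩ ⟨i + 1, hi⟩ rfl
          have := h.x_neg
          linarith
        have h1 : HasExpOrder (fun τ => eval (P τ) (S.r s ⟨i, hi'⟩))
            (S.N s ⟨i, hi'⟩ * d (.u s ⟨i, hi'⟩)) := by
          refine HasExpOrder.eval (fun μ hμ w hw => ?_) fun μ hμ => (h.weight_r_lt hi hμ).le
          rcases mem_of_mem_supported (S.r_supported s _ hi) hμ hw with (rfl | rfl) | ⟨j, hj, rfl⟩
          · exact hy
          · exact hz
          · exact ih j (Nat.lt_succ_of_le hj) j.2
        have h2 := (((ih i (by omega) hi').pow (S.N s ⟨i, hi'⟩)).sub h1).mono hle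
        refine (h2.mul_tendsto (hxc s)).congr' ?_
        filter_upwards [hxcne s] with τ hτ
        have := hPV τ _ (.u_next s ⟨i, hi'⟩ ⟨i + 1, hi⟩ rfl)
        simp only [map_sub, map_add, map_mul, map_pow, eval_X, eval_C] at this
        rw [← div_eq_mul_inv, div_eq_iff hτ]
        linear_combination -this
  obtain ⟨φ, hφ⟩ := exists_character hPV (d := d) fun j => by
    match j with
    | .x => exact hx
    | .y => exact hy
    | .z => exact hz
    | .v i => exact hv i i.2
    | .u s i => exact hu s i i.2
  have hlim : ∀ {j : Coord m p M} {a : ℂ},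
      (fun τ => (Real.exp (τ * d j) : ℂ) * a) =ᶠ[atTop] (fun τ => P τ j) →
        φ (S.coord d j) = a := by
    intro j a hj
    refine tendsto_nhds_unique (hφ j) (tendsto_const_nhds.congr' ?_)
    filter_upwards [hj] with τ hτ
    rw [← hτ, mul_right_comm, ← Complex.ofReal_mul, ← Real.exp_add]
    simp
  exact ⟨φ, hlim hPx, hlim hPy, hlim hPz⟩

end SystemData

end Points

/-! ### The associated graded algebra of `X'` -/

section AssociatedGraded

open MvPolynomial

theorem IsBihomMonomial.mul {k l m : ℕ} {n : ℕ → ℕ} {R : Type*} [CommRing R] {x y z : R} {v : ℕ → R}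
    {g g' : ℤ} {τ τ' : ℕ} {r r' : R} (h : IsBihomMonomial k l m n x y z v g τ r)
    (h' : IsBihomMonomial k l m n x y z v g' τ' r') :
    IsBihomMonomial k l m n x y z v (g + g') (τ + τ') (r * r') := by
  induction h with
  | one => simpa using h'
  | mul_x _ ih => rw [mul_assoc, add_right_comm]; exact ih.mul_x
  | mul_y _ ih => rw [mul_assoc, add_right_comm]; exact ih.mul_y
  | mul_z _ ih => rw [mul_assoc, add_right_comm]; exact ih.mul_z
  | mul_v i hi _ ih => rw [mul_assoc (v i), add_right_comm, sub_add_eq_add_sub]; exact ih.mul_v i hi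

namespace SystemData

variable {m p : ℕ} {M : Fin p → ℕ} {S : SystemData m p M} {d : Coord m p M → ℝ}

/-- The exponents `n_i`, indexed by the natural numbers. -/
def exponent (S : SystemData m p M) (i : ℕ) : ℕ := if h : i < m then S.n ⟨i, h⟩ else 0

/-- The elements `v_i` of the associated graded algebra, indexed by the natural numbers. -/
noncomputable def grV (S : SystemData m p M) (d : Coord m p M → ℝ) (i : ℕ) : S.GrA d :=
  if h : i < m then S.coord d (.v ⟨i, h⟩) else 0

theorem exponent_of_lt {i : ℕ} (hi : i < m) : S.exponent i = S.n ⟨i, hi⟩ := dif_pos hi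

theorem grV_of_lt {i : ℕ} (hi : i < m) : S.grV d i = S.coord d (.v ⟨i, hi⟩) := dif_pos hi

theorem adjoin_coord_eq_top (h : S.IsAdmissible S.threshold d) :
    Algebra.adjoin ℂ ({S.coord d .x, S.coord d .y, S.coord d .z} ∪ S.grV d '' Set.Iio m) = ⊤ := by
  set B := Algebra.adjoin ℂ ({S.coord d .x, S.coord d .y, S.coord d .z} ∪ S.grV d '' Set.Iio m)
    with hB
  have hcoord : ∀ j, S.coord d j ∈ B := by
    intro j
    match j with
    | .x => exact Algebra.subset_adjoin (by simp)
    | .y => exact Algebra.subset_adjoin (by simp)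
    | .z => exact Algebra.subset_adjoin (by simp)
    | .v i => exact Algebra.subset_adjoin (.inr ⟨i, i.2, grV_of_lt i.2⟩)
    | .u s i => rw [coord_u h]; exact Subalgebra.zero_mem _
  rw [eq_top_iff]
  intro g _
  refine (Submodule.span_le (p := Subalgebra.toSubmodule B)).2 ?_
    (RealFiltration.mem_span_isHomogeneousElt g)
  rintro _ ⟨t, a, rfl⟩
  refine (Submodule.span_le (p := Subalgebra.toSubmodule B)).2 ?_ (mem_span_of_symbol a)
  rintro _ ⟨μ, -, rfl⟩
  exact Subalgebra.prod_mem _ fun j _ => Subalgebra.pow_mem _ (hcoord j) _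

theorem isModification (hm : 0 < m) (h : S.IsAdmissible S.threshold d) :
    IsModification S.k S.l m S.exponent (S.coord d .x) (S.coord d .y) (S.coord d .z)
      (S.grV d) where
  two_le_k := by have := S.two_le_l; have := S.l_lt_k; omega
  two_le_l := S.two_le_l
  coprime := S.coprime
  m_pos := hm
  n_pos i hi := by
    rw [exponent_of_lt (by omega)]
    exact (Nat.zero_le _).trans_lt (S.q_degree ⟨i, by omega⟩ ⟨i, by omega⟩ hi le_rfl)
  rel_zero := by
    rw [grV_of_lt hm]
    exact coord_v_first h rfl
  rel_succ i hi := by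
    rw [grV_of_lt hi, grV_of_lt (by omega), exponent_of_lt (by omega)]
    exact coord_v_next h rfl
  adjoin_eq_top := adjoin_coord_eq_top h
  exists_point _ b c ha := exists_character_coord h b c ha

theorem weight_v (h : S.IsAdmissible S.threshold d) (i : ℕ) (hi : i < m) :
    d (.v ⟨i, hi⟩) = wExp S.exponent i * (S.k * d .y) - xExp S.exponent i * d .x := by
  induction i with
  | zero =>
    have := h.v_first ⟨0, hi⟩ rfl
    simp only [wExp, xExp, Nat.cast_one, one_mul]
    linarith
  | succ i ih =>
    have h1 := h.v_next ⟨i, by omega⟩ ⟨i + 1, hi⟩ rfl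
    rw [ih (by omega)] at h1
    simp only [wExp, xExp, exponent_of_lt (show i < m by omega)]
    push_cast
    linarith

/-- A nonzero monomial of the associated graded algebra has a bidegree, and this determines its
weight. -/
theorem exists_bidegree (h : S.IsAdmissible S.threshold d) (μ : Coord m p M →₀ ℕ)
    (hμ : μ.prod (fun j e => S.coord d j ^ e) ≠ 0) :
    ∃ g τ, IsBihomMonomial S.k S.l m S.exponent (S.coord d .x) (S.coord d .y) (S.coord d .z)
      (S.grV d) g τ (μ.prod fun j e => S.coord d j ^ e) ∧
      S.l * Finsupp.weight d μ = S.l * g * d .x + τ * d .y := by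
  induction μ using Finsupp.induction_linear with
  | zero => exact ⟨0, 0, by simpa using .one, by simp⟩
  | add μ ν ihμ ihν =>
    rw [Finsupp.prod_add_index' (by simp) (by intros; ring)] at hμ ⊢
    obtain ⟨g, τ, h1, h2⟩ := ihμ (left_ne_zero_of_mul hμ)
    obtain ⟨g', τ', h1', h2'⟩ := ihν (right_ne_zero_of_mul hμ)
    refine ⟨_, _, h1.mul h1', ?_⟩
    rw [map_add]
    push_cast
    linarith
  | single j e =>
    rw [Finsupp.prod_single_index (by simp)] at hμ ⊢
    rw [Finsupp.weight_single, nsmul_eq_mul]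
    have hpow : ∀ {g : ℤ} {τ : ℕ}, IsBihomMonomial S.k S.l m S.exponent (S.coord d .x)
        (S.coord d .y) (S.coord d .z) (S.grV d) g τ (S.coord d j * 1) →
        IsBihomMonomial S.k S.l m S.exponent (S.coord d .x) (S.coord d .y) (S.coord d .z)
          (S.grV d) (e * g) (e * τ) (S.coord d j ^ e) := by
      intro g τ hg
      rw [mul_one] at hg
      clear hμ
      induction e with
      | zero => simpa using .one
      | succ e ih =>
        rw [pow_succ]
        convert ih.mul hg using 1
        · push_cast; ring
        · ring
    match j with
    | .x => exact ⟨_, _, hpow (.mul_x .one), by push_cast; ring⟩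
    | .y => exact ⟨_, _, hpow (.mul_y .one), by push_cast; ring⟩
    | .z =>
      refine ⟨_, _, hpow (.mul_z .one), ?_⟩
      push_cast
      linear_combination (-e : ℝ) * h.y_z
    | .v ⟨i, hi⟩ =>
      refine ⟨_, _, hpow (by rw [← grV_of_lt hi]; exact .mul_v i hi .one), ?_⟩
      rw [weight_v h i hi]
      push_cast
      ring
    | .u s i =>
      have he : e = 0 := by
        by_contra he
        exact hμ (by rw [coord_u h, zero_pow he])
      subst he
      exact ⟨0, 0, by simpa using .one, by simp⟩

/-- The weights of `x` and `y` are linearly independent over `ℚ`. -/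
theorem bidegree_unique (hm : 0 < m) (h : S.IsAdmissible S.threshold d) {g g' : ℤ} {τ τ' : ℕ}
    (hg : S.l * g * d .x + τ * d .y = S.l * g' * d .x + τ' * d .y) : g = g' ∧ τ = τ' := by
  have h1 := LinearIndependent.pair_iff.1 (h.indep ⟨0, hm⟩ rfl)
    ((τ : ℚ) - τ') (S.k * S.l * ((g : ℚ) - g') + (τ - τ')) (by
      have h2 := h.v_first ⟨0, hm⟩ rfl
      simp only [Rat.smul_def]
      push_cast
      linear_combination S.k * hg + ((τ : ℝ) - τ') * h2)
  obtain ⟨h2, h3⟩ := h1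
  have hk : (S.k : ℚ) ≠ 0 := by
    have := S.l_lt_k
    exact_mod_cast show S.k ≠ 0 by omega
  have hl : (S.l : ℚ) ≠ 0 := by
    have := S.two_le_l
    exact_mod_cast show S.l ≠ 0 by omega
  rw [h2, add_zero] at h3
  have h4 := (mul_eq_zero.1 h3).resolve_left (mul_ne_zero hk hl)
  exact ⟨by exact_mod_cast sub_eq_zero.1 h4, by exact_mod_cast sub_eq_zero.1 h2⟩

theorem exists_mem_span_bihom (hm : 0 < m) (h : S.IsAdmissible S.threshold d) {a : S.GrA d}
    (ha : (S.filtration d).IsHomogeneousElt a) (ha0 : a ≠ 0) :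
    ∃ g τ, a ∈ Submodule.span ℂ {r | IsBihomMonomial S.k S.l m S.exponent (S.coord d .x)
      (S.coord d .y) (S.coord d .z) (S.grV d) g τ r} := by
  obtain ⟨t, a, rfl⟩ := ha
  have hspan := mem_span_of_symbol a
  by_cases hex : ∃ μ : Coord m p M →₀ ℕ, Finsupp.weight d μ = t ∧
      μ.prod (fun j e => S.coord d j ^ e) ≠ 0
  · obtain ⟨μ, hμt, hμ⟩ := hex
    obtain ⟨g, τ, -, h1⟩ := exists_bidegree h μ hμ
    refine ⟨g, τ, Submodule.span_le.2 ?_ hspan⟩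
    rintro _ ⟨ν, hνt, rfl⟩
    by_cases hν : ν.prod (fun j e => S.coord d j ^ e) = 0
    · exact hν ▸ Submodule.zero_mem _
    · obtain ⟨g', τ', h2, h3⟩ := exists_bidegree h ν hν
      rw [hμt] at h1
      rw [hνt, h1] at h3
      obtain ⟨rfl, rfl⟩ := bidegree_unique hm h h3
      exact Submodule.subset_span h2
  · push Not at hex
    refine absurd ?_ ha0
    rw [← Submodule.mem_bot ℂ]
    refine Submodule.span_le.2 ?_ hspan
    rintro _ ⟨ν, hνt, rfl⟩
    exact hex ν hνt

end SystemData

end AssociatedGraded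

theorem proposition5p3 {m p : ℕ} {M : Fin p → ℕ} (hm : 2 ≤ m) (S : SystemData m p M) :
    ∃ C : ℝ, ∀ d : Coord m p M → ℝ, S.IsAdmissible C d →
      ∀ (a₁ a₂ : S.GrA d) (δ : Derivation ℂ (S.GrA d) (S.GrA d)),
        Irreducible a₁ → Irreducible a₂ →
        (S.filtration d).IsHomogeneousElt a₁ → (S.filtration d).IsHomogeneousElt a₂ →
        IsJacobianType (S.coord d .x) (S.coord d .y) (S.coord d .z) m a₁ a₂ δ →
        IsLocallyNilpotent δ → δ ≠ 0 →
        (∃ α β : ℂ, α ≠ 0 ∧ β ≠ 0 ∧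
          ((a₁ = α • S.coord d .x ∧ a₂ = β • S.coord d .y) ∨
           (a₁ = α • S.coord d .x ∧ a₂ = β • S.coord d .z) ∨
           (a₁ = α • S.coord d .y ∧ a₂ = β • S.coord d .x) ∨
           (a₁ = α • S.coord d .z ∧ a₂ = β • S.coord d .x))) ∧
        δ (S.coord d .x) = 0 ∧
        ∀ i : Fin m, 2 ≤ derivationDegree δ (S.coord d (.v i)) := by
  refine ⟨S.threshold, fun d hd a₁ a₂ δ ha₁ ha₂ hh₁ hh₂ hJ hδ hδ0 => ?_⟩
  have hmod := SystemData.isModification (by omega) hd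
  have := hmod.isDomain
  obtain ⟨g₁, τ₁, hsp₁⟩ := SystemData.exists_mem_span_bihom (by omega) hd hh₁ ha₁.ne_zero
  obtain ⟨g₂, τ₂, hsp₂⟩ := SystemData.exists_mem_span_bihom (by omega) hd hh₂ ha₂.ne_zero
  obtain ⟨α, hα, s₁, hs₁, rfl⟩ := hmod.exists_eq_smul_primitive hsp₁ ha₁
  obtain ⟨β, hβ, s₂, hs₂, rfl⟩ := hmod.exists_eq_smul_primitive hsp₂ ha₂
  have h1 : δ s₁ = 0 := by simpa [hα] using hJ.map_left
  have h2 : δ s₂ = 0 := by simpa [hβ] using hJ.map_right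
  have hcases := hmod.classification hm hδ hδ0 hα hβ hs₁ hs₂ hJ
  have hker : δ (S.coord d .x) = 0 ∧ (δ (S.coord d .y) = 0 ∨ δ (S.coord d .z) = 0) := by
    rcases hcases with ⟨rfl, rfl⟩ | ⟨rfl, rfl⟩ | ⟨rfl, rfl⟩ | ⟨rfl, rfl⟩
    exacts [⟨h1, .inl h2⟩, ⟨h1, .inr h2⟩, ⟨h2, .inl h1⟩, ⟨h2, .inr h1⟩]
  refine ⟨⟨α, β, hα, hβ, ?_⟩, hker.1, fun i => ?_⟩
  · rcases hcases with ⟨rfl, rfl⟩ | ⟨rfl, rfl⟩ | ⟨rfl, rfl⟩ | ⟨rfl, rfl⟩ <;> simp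
  · rw [← SystemData.grV_of_lt i.2]
    exact hmod.two_le_degree_v hδ hδ0 hker.1 hker.2 i.2
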